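/- Let $\mathcal L$ be a first-order (one-sorted) language expanding the language of valued fields (the ring language together with a unary predicate for the valuation ring), and let $K$ be a valued field of characteristic $0$, considered as an $\mathcal L$-structure expanding its valued field structure. Write $|\cdot|$ for the valuation, with multiplicative value group $\Gamma_K^\times$. For $\lambda\in\Gamma_K^\times$ with $\lambda\le 1$ let $\mathrm{RV}_{\lambda,K}=(K^\times/\{x:|x-1|<\lambda\})\cup\{0\}$, with canonical map $\mathrm{rv}_\lambda\colon K\to \mathrm{RV}_{\lambda,K}$. A set $X\subseteq K$ is $\lambda$-prepared by $C\subseteq K$ if, for all $x,x'\in K$ with $\mathrm{rv}_\lambda(x-c)=\mathrm{rv}_\lambda(x'-c)$ for all $c\in C$, one has $x\in X\iff x'\in X$. "$B$-definable" means definable with parameters from $B$, where $\mathrm{RV}_{|n|,K}$ ($n\ge 1$ an integer) is regarded as an imaginary sort. A theory $T$ of valued fields of residue characteristic $0$ in the language $\mathcal L$ is $0$-h-minimal if for every model $M$ of $T$ and every $A\subseteq M$, every $(A\cup \mathrm{RV}_{1,M})$-definable set $X\subseteq M$ is $1$-prepared by some finite $A$-definable set $C\subseteq M$. A theory $T$ of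 valued fields of characteristic $0$ in the language $\mathcal L$ is $0$-h$^{\mathrm{mix}}$-minimal if for every model $M$ of $T$, every $A\subseteq M$ and every integer $n\ge1$, every $(A\cup \mathrm{RV}_{|n|,M})$-definable set $X\subseteq M$ is $|m|$-prepared by some finite $A$-definable set $C\subseteq M$, for some integer $m\ge 1$. Theorem. Suppose that either (1) the residue characteristic of $K$ is $0$ and $\mathrm{Th}(K)$ is $0$-h-minimal; or (2) $K$ has residue characteristic a prime $p$, $K$ is finitely ramified (i.e. there are only finitely many $\gamma\in\Gamma_K^\times$ with $|p|\le\gamma\le 1$), and $\mathrm{Th}(K)$ is $0$-h$^{\mathrm{mix}}$-minimal. Then $K$ has an elementary extension $L\succ K$ (as an $\mathcal L$-structure) which is an immediate extension of $K$ (same value group and same residue field), which is spherically complete (every chain of open or closed valuative balls in $L$ has non-empty intersection), and which is, hence, maximal (it has no proper immediate valued field extension). -/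

import Mathlib

open FirstOrder

universe u v w

/-- The relation symbols of the valued field language: one unary predicate. -/
inductive ValuedFieldRel : ℕ → Type
  | integer : ValuedFieldRel 1

/-- The language of valued fields: the language of rings (`+`, `*`, `-`, `0`, `1`) together with
a unary predicate for the valuation ring. -/
def valuedFieldLanguage : FirstOrder.Language.{0, 0} where
  Functions := FirstOrder.Language.ring.Functions
  Relations := ValuedFieldRel

/-- A valued field, given as a field `K` with a valuation ring `O`, viewed as a structure in the
language of valued fields. -/
@[reducible] def valuedFieldStructure {K : Type w} [Field K] (O : ValuationSubring K) :
    valuedFieldLanguage.Structure K where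
  funMap := fun {n} (f : FirstOrder.ringFunc n) =>
    match n, f with
    | _, .add => fun x => x 0 + x 1
    | _, .mul => fun x => x 0 * x 1
    | _, .neg => fun x => - x 0
    | _, .zero => fun _ => 0
    | _, .one => fun _ => 1
  RelMap := fun {n} (r : ValuedFieldRel n) =>
    match n, r with
    | _, .integer => fun x => x 0 ∈ O

/-- The language `L` expands the valued field language through `φ`. This says that the
`L`-structure on the valued field `(K, O)` expands its valued field structure. -/
def IsValuedFieldExpansion {L : FirstOrder.Language.{u, v}} (φ : valuedFieldLanguage →ᴸ L)
    {K : Type w} [Field K] [L.Structure K] (O : ValuationSubring K) : Prop :=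
  @FirstOrder.Language.LHom.IsExpansionOn valuedFieldLanguage L φ K (valuedFieldStructure O) _

section LeadingTerms

variable {K : Type w} [Field K] (O : ValuationSubring K)

/-- The elements `r` of the value group (written multiplicatively) with `r ≤ 1`. -/
abbrev RVRadius : Type w := Set.Ioc (0 : O.ValueGroup) 1

/-- The open ball `B_{<r}(1)` as a subgroup of the multiplicative group of `K`. -/
def unitBall (r : RVRadius O) : Subgroup Kˣ where
  carrier := {a | O.valuation ((a : K) - 1) < r.1}
  one_mem' := by simpa using r.2.1
  mul_mem' := by
    intro a b ha hb
    have e : (((a * b : Kˣ) : K) - 1) = ((a : K) - 1) * ((b : K) - 1)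
        + (((a : K) - 1) + ((b : K) - 1)) := by
      push_cast; ring
    simp only [Set.mem_ofPred_eq] at ha hb ⊢
    rw [e]
    refine O.valuation.map_add_lt ?_ (O.valuation.map_add_lt ha hb)
    rw [map_mul]
    calc O.valuation ((a : K) - 1) * O.valuation ((b : K) - 1)
        ≤ O.valuation ((a : K) - 1) * 1 := by
          gcongr
          exact (hb.trans_le r.2.2).le
      _ < r.1 := by simpa using ha
  inv_mem' := by
    intro a ha
    simp only [Set.mem_ofPred_eq] at ha ⊢
    have h1 : O.valuation (a : K) = 1 := by
      have := O.valuation.map_one_add_of_lt (x := (a : K) - 1) (ha.trans_le r.2.2)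
      simpa using this
    have e : ((a⁻¹ : Kˣ) : K) - 1 = -(((a : K) - 1) * ((a⁻¹ : Kˣ) : K)) := by
      rw [sub_mul, Units.mul_inv]; ring
    rw [e, Valuation.map_neg, map_mul, Units.val_inv_eq_inv_val, map_inv₀, h1]
    simpa using ha

/-- The leading term structure `RV_r = (Kˣ / B_{<r}(1)) ∪ {0}`. -/
abbrev RV (r : RVRadius O) : Type w := WithZero (Kˣ ⧸ unitBall O r)

open Classical in
/-- The leading term map `rv_r : K → RV_r`. -/
noncomputable def rv (r : RVRadius O) (x : K) : RV O r :=
  if h : x = 0 then 0 else ((QuotientGroup.mk (Units.mk0 x h) : Kˣ ⧸ unitBall O r) : RV O r)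

/-- The radius `|1|`. -/
noncomputable def oneRadius : RVRadius O := ⟨1, zero_lt_one, le_rfl⟩

/-- The radius `|m|`, for an integer `m ≥ 1`, in a valued field of characteristic zero. -/
noncomputable def natRadius [CharZero K] (m : ℕ+) : RVRadius O :=
  ⟨O.valuation ((m : ℕ) : K), by
    refine ⟨?_, ?_⟩
    · rw [Valuation.pos_iff]
      exact_mod_cast m.ne_zero
    · exact (O.valuation_le_one_iff _).2 (natCast_mem O _)⟩

/-- `X ⊆ K` is `r`-prepared by `C ⊆ K`: whether `x ∈ X` holds depends only on the tuple
`(rv_r (x - c))_{c ∈ C}`. -/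
def IsPreparedBy (r : RVRadius O) (X C : Set K) : Prop :=
  ∀ x x' : K, (∀ c ∈ C, rv O r (x - c) = rv O r (x' - c)) → (x ∈ X ↔ x' ∈ X)

/-- `W ⊆ K × RV_r ^ k` is definable with parameters from `A ⊆ K`. Since `RV_r` is a quotient of
`K`, this means that the preimage of `W` in `K × K ^ k` is `A`-definable. -/
def IsRVFamilyDefinable (L : FirstOrder.Language.{u, v}) [L.Structure K] (A : Set K)
    (r : RVRadius O) {k : ℕ} (W : Set (K × (Fin k → RV O r))) : Prop :=
  A.Definable L {y : Fin (k + 1) → K | (y 0, fun i : Fin k => rv O r (y i.succ)) ∈ W}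

/-- `X ⊆ K` is `(A ∪ RV_r)`-definable: it is the fiber, over a finite tuple of elements of `RV_r`,
of an `A`-definable family indexed by tuples from `RV_r`. -/
def IsDefinableOverRV (L : FirstOrder.Language.{u, v}) [L.Structure K] (A : Set K)
    (r : RVRadius O) (X : Set K) : Prop :=
  ∃ (k : ℕ) (W : Set (K × (Fin k → RV O r))) (ξ : Fin k → RV O r),
    IsRVFamilyDefinable O L A r W ∧ X = {x | (x, ξ) ∈ W}

end LeadingTerms

/-- `0`-h-minimality of a theory `T` of valued fields (of residue characteristic zero): in every
model `K`, for every `A ⊆ K`, every `(A ∪ RV)`-definable subset of `K` is `1`-prepared by some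
finite `A`-definable set. The models range over the universe `w`. -/
def IsZeroHMinimal {L : FirstOrder.Language.{u, v}} (φ : valuedFieldLanguage →ᴸ L)
    (T : L.Theory) : Prop :=
  ∀ (K : Type w) [Field K] [L.Structure K] (O : ValuationSubring K),
    IsValuedFieldExpansion φ O → K ⊨ T →
    ∀ (A X : Set K), IsDefinableOverRV O L A (oneRadius O) X →
      ∃ C : Set K, C.Finite ∧ A.Definable₁ L C ∧ IsPreparedBy O (oneRadius O) X C

/-- `0`-h^mix-minimality of a theory `T` of valued fields of characteristic zero: in every
model `K`, for every `A ⊆ K` and every integer `n ≥ 1`, every `(A ∪ RV_{|n|})`-definable subset of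
`K` is `|m|`-prepared by some finite `A`-definable set, for some integer `m ≥ 1`. The models range
over the universe `w`. -/
def IsZeroHMixMinimal {L : FirstOrder.Language.{u, v}} (φ : valuedFieldLanguage →ᴸ L)
    (T : L.Theory) : Prop :=
  ∀ (K : Type w) [Field K] [CharZero K] [L.Structure K] (O : ValuationSubring K),
    IsValuedFieldExpansion φ O → K ⊨ T →
    ∀ (n : ℕ+) (A X : Set K), IsDefinableOverRV O L A (natRadius O n) X →
      ∃ (m : ℕ+) (C : Set K), C.Finite ∧ A.Definable₁ L C ∧ IsPreparedBy O (natRadius O m) X C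

/-- The valued field `(K, O)` has residue characteristic `p`, and only finitely many values lie
between `|p|` and `1`. -/
def IsFinitelyRamified {K : Type w} [Field K] (O : ValuationSubring K) (p : ℕ) : Prop :=
  CharP (IsLocalRing.ResidueField O) p ∧ (Set.Icc (O.valuation (p : K)) 1).Finite

/-- `i` is an embedding of valued fields `(K, O) → (K', O')` which makes `K'` an immediate extension
of `K`: the value group and the residue field do not grow. -/
structure IsImmediateExtension {K : Type u} {K' : Type v} [Field K] [Field K']
    (O : ValuationSubring K) (O' : ValuationSubring K') (i : K →+* K') : Prop where
  comap_eq : O'.comap i = O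
  value : ∀ y : K', ∃ x : K, O'.valuation (i x) = O'.valuation y
  residue : ∀ y ∈ O', ∃ x ∈ O, O'.valuation (y - i x) < 1

/-- The valuative balls, open or closed, with radius in the value group. -/
def IsValuativeBall {K : Type w} [Field K] (O : ValuationSubring K) (B : Set K) : Prop :=
  ∃ (a : K) (r : O.ValueGroup), r ≠ 0 ∧
    (B = {x | O.valuation (x - a) < r} ∨ B = {x | O.valuation (x - a) ≤ r})

/-- Every chain of valuative balls has non-empty intersection. -/
def IsSphericallyComplete {K : Type w} [Field K] (O : ValuationSubring K) : Prop :=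
  ∀ 𝓑 : Set (Set K), (∀ B ∈ 𝓑, IsValuativeBall O B) → IsChain (· ⊆ ·) 𝓑 → (⋂₀ 𝓑).Nonempty

/-- `(K, O)` has no proper immediate extension. -/
def IsMaximalValuedField {K : Type w} [Field K] (O : ValuationSubring K) : Prop :=
  ∀ (K' : Type w) [Field K'] (O' : ValuationSubring K') (i : K →+* K'),
    IsImmediateExtension O O' i → Function.Surjective i

/-! ### Equality of leading terms in terms of the valuation. -/

section LeadingTermEquality

variable {K : Type w} [Field K] {O : ValuationSubring K}

/-! Among the immediate elementary extensions of `K` there is one, `N`, with no proper further one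
(`exists_maximal_isImmediateEmbedding`); it has to be spherically complete. Suppose a chain of balls
of `N` has empty intersection. An ultrapower `M` of `N` has a point `a` in all of these balls. It
suffices to find an elementary substructure of `M` that contains `N` and `a` and whose leading terms
all come from `N`: it is a proper immediate elementary extension of `N`.

Call a parameter set `A ⊇ N` controlled if every nonempty `A`-definable subset of every `RV_{|n|}`
meets the image of `N`. Then `N ∪ {a}` is controlled (`IsRVControlled.insert_of_mem_chain`). Indeed,
for a definable condition `W(a, y)` on a leading term `y`, the set of `x` with `W(x, y)` is prepared
by finitely many centres, all in `N`. No centre lies in all balls and only finitely many values lie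
between `|m|` and `1`, so `rv_{|m|}(x - c)` is constant on a small ball (`exists_ball_rv_sub_eq`).
Hence `W(x, y)` holds on a whole ball, and this condition on `y` is over `N`, thus solvable in `N`.

By Zorn there is a maximal controlled `A` containing `N ∪ {a}`. It contains all finite `A`-definable
sets (`insert_of_mem_finite`). By preparation, each nonempty `A`-definable set contains a centre in
`A` plus an element of `N`, so the Tarski–Vaught test holds (`meetsDefinable_of_maximal`). The
leading term of an element of `A` is an `A`-definable singleton, hence comes from `N`. -/

theorem rv_eq_rv_iff {r : RVRadius O} {x y : K} :
    rv O r x = rv O r y ↔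
      (x = 0 ∧ y = 0) ∨ O.valuation (x - y) < r.1 * O.valuation y := by
  by_cases hx : x = 0
  · subst hx
    by_cases hy : y = 0
    · simp [hy]
    · have h1 : r.1 * O.valuation y ≤ O.valuation y := mul_le_of_le_one_left' r.2.2
      simp [rv, hy, h1]
  · by_cases hy : y = 0
    · subst hy
      simp [rv, hx]
    · have hy' : 0 < O.valuation y := (Valuation.pos_iff _).2 hy
      have e : y⁻¹ * x - 1 = (x - y) * y⁻¹ := by field_simp
      have h1 : rv O r y = rv O r x ↔
          O.valuation ((((Units.mk0 y hy)⁻¹ * Units.mk0 x hx : Kˣ) : K) - 1) < r.1 := by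
        rw [rv, rv, dif_neg hx, dif_neg hy, WithZero.coe_inj, QuotientGroup.eq]
        rfl
      rw [eq_comm, h1, Units.val_mul, Units.val_inv_eq_inv_val, Units.val_mk0, Units.val_mk0, e,
        map_mul, map_inv₀, ← div_eq_mul_inv, div_lt_iff₀ hy']
      simp [hx]

/-- Two elements with the same leading term of order `|n|`, in a form that does not mention
the leading term structure. -/
theorem rv_natRadius_eq_iff [CharZero K] {n : ℕ+} {x y : K} :
    rv O (natRadius O n) x = rv O (natRadius O n) y ↔
      (x = 0 ∧ y = 0) ∨ ¬ O.valuation (((n : ℕ) : K) * y) ≤ O.valuation (x - y) := by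
  rw [rv_eq_rv_iff, map_mul, not_le]; rfl

end LeadingTermEquality

/-! ### Closure rules for definable sets. -/

section DefinabilityRules

open FirstOrder.Language Set

variable {L : FirstOrder.Language.{u, v}} {M : Type w} [L.Structure M] {A : Set M} {α : Type*}

theorem Set.Definable.exists_one {P : M → (α → M) → Prop}
    (h : A.Definable L {w : Option α → M | P (w none) (fun a => w (some a))}) :
    A.Definable L {v : α → M | ∃ x, P x v} := by
  have h1 : A.Definable L {w : α ⊕ Unit → M | P (w (Sum.inr ())) (fun a => w (Sum.inl a))} :=
    h.preimage_comp (fun o : Option α => o.elim (Sum.inr ()) Sum.inl)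
  convert! h1.exists_of_finite using 1
  ext v
  exact ⟨fun ⟨x, hx⟩ => ⟨fun _ => x, hx⟩, fun ⟨x, hx⟩ => ⟨x (), hx⟩⟩

theorem Set.Definable.not {P : (α → M) → Prop} (h : A.Definable L {v | P v}) :
    A.Definable L {v | ¬ P v} := h.compl

theorem Set.Definable.and {P Q : (α → M) → Prop} (h : A.Definable L {v | P v})
    (h' : A.Definable L {v | Q v}) : A.Definable L {v | P v ∧ Q v} := h.inter h'

theorem Set.Definable.or {P Q : (α → M) → Prop} (h : A.Definable L {v | P v})
    (h' : A.Definable L {v | Q v}) : A.Definable L {v | P v ∨ Q v} := h.union h'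

theorem Set.Definable.imp {P Q : (α → M) → Prop} (h : A.Definable L {v | P v})
    (h' : A.Definable L {v | Q v}) : A.Definable L {v | P v → Q v} := by
  convert! h.not.or h' using 3
  exact imp_iff_not_or

theorem Set.Definable.forall_one {P : M → (α → M) → Prop}
    (h : A.Definable L {w : Option α → M | P (w none) (fun a => w (some a))}) :
    A.Definable L {v : α → M | ∀ x, P x v} := by
  convert! (Set.Definable.exists_one (P := fun x v => ¬ P x v) h.not).not using 3
  exact not_exists_not.symm

theorem Set.Definable.comp_one {S : Set M} (hS : A.Definable₁ L S) {f : (α → M) → M}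
    (hf : A.DefinableFun L f) : A.Definable L {v | f v ∈ S} :=
  Set.Definable.preimage_map (F := fun v (_ : Fin 1) => f v) (fun _ => hf) hS

theorem Set.Definable.comp_two {W : M → M → Prop}
    (hW : A.Definable L {v : Fin 2 → M | W (v 0) (v 1)}) {f g : (α → M) → M}
    (hf : A.DefinableFun L f) (hg : A.DefinableFun L g) : A.Definable L {v | W (f v) (g v)} :=
  Set.Definable.preimage_map (F := fun v => ![f v, g v])
    (fun i => by fin_cases i; exacts [hf, hg]) hW

/-- Adjoining one parameter amounts to taking a fibre. -/
theorem Set.Definable₁.exists_fibre {c : M} {Y : Set M} (h : (insert c A).Definable₁ L Y) :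
    ∃ W : M → M → Prop, A.Definable L {v : Fin 2 → M | W (v 0) (v 1)} ∧ Y = {y | W c y} := by
  classical
  obtain ⟨θ, hθ⟩ := definable_iff_exists_formula_sum.1 h
  -- Parameters in `A` stay parameters; only `c`, when outside `A`, becomes the variable `0`.
  let g : ((insert c A : Set M) ⊕ Fin 1) → A ⊕ Fin 2 :=
    Sum.elim (fun a => if ha : (a : M) ∈ A then Sum.inl ⟨a, ha⟩ else Sum.inr 0)
      (fun _ => Sum.inr 1)
  refine ⟨fun x y => (θ.relabel g).Realize (Sum.elim (↑) ![x, y]),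
    definable_iff_exists_formula_sum.2 ⟨θ.relabel g, ?_⟩, ?_⟩
  · ext v
    have : ![v 0, v 1] = v := by ext i; fin_cases i <;> rfl
    simp [this]
  · ext y
    have h1 : y ∈ Y ↔ (fun _ : Fin 1 => y) ∈ {x : Fin 1 → M | x 0 ∈ Y} := Iff.rfl
    rw [h1, hθ]
    simp only [Set.mem_ofPred_eq, Formula.realize_relabel]
    refine iff_of_eq (congrArg _ ?_)
    ext i
    rcases i with ⟨a, ha⟩ | i
    · by_cases hA : a ∈ A
      · simp [g, hA]
      · simp only [Sum.elim_inl, Function.comp_apply, hA, dite_false, Sum.elim_inr, g,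
          Matrix.cons_val_zero]
        exact ha.resolve_right hA
    · simp [g]

/-- The finite set `C ∩ A` is `A`-definable, so what remains of `C` is an `A`-definable set without
points of `A`, and must be empty. -/
theorem FirstOrder.Language.MeetsDefinable.subset_of_finite (hA : L.MeetsDefinable A) {C : Set M}
    (hfin : C.Finite) (hC : A.Definable₁ L C) : C ⊆ A := by
  by_contra hCA
  obtain ⟨c, hcC, hcA⟩ := not_subset.1 hCA
  have hfin' : (C ∩ A).Finite := hfin.inter_of_left A
  have hdef : A.Definable₁ L (C \ (C ∩ A)) := by
    refine hC.sdiff (t := {v : Fin 1 → M | v 0 ∈ C ∩ A}) ?_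
    -- The clause `i ∈ A` is automatic, but makes the piece definable for every index `i`, as the
    -- rule for finite unions demands.
    have : {v : Fin 1 → M | v 0 ∈ C ∩ A} =
        ⋃ i ∈ hfin'.toFinset, {v : Fin 1 → M | v 0 ∈ ({i} : Set M) ∧ i ∈ A} := by
      ext v
      simp only [mem_ofPred_eq, mem_iUnion, Finite.mem_toFinset, mem_singleton_iff, exists_prop]
      exact ⟨fun h => ⟨_, h, rfl, h.2⟩, fun ⟨i, hi, hv, _⟩ => hv ▸ hi⟩
    rw [this]
    refine definable_biUnion_finset (fun i => ?_) _
    by_cases hi : i ∈ A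
    · simp only [hi, and_true]
      exact Definable.singleton_of_mem L hi
    · simp [hi]
  obtain ⟨d, hd, hdA⟩ := hA (C \ (C ∩ A)) ⟨c, hcC, fun h => hcA h.2⟩ hdef
  exact hd.2 ⟨hd.1, hdA⟩

end DefinabilityRules

/-! ### Definability of the field operations, the valuation and leading terms. -/

section ValuedFieldDefinability

open FirstOrder.Language Set

variable {L : FirstOrder.Language.{u, v}} {φ : valuedFieldLanguage →ᴸ L} {M : Type w} [Field M]
  [L.Structure M] {O : ValuationSubring M} {A : Set M} {α : Type*}

namespace IsValuedFieldExpansion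

theorem funMap_add (h : IsValuedFieldExpansion φ O) (x y : M) :
    Structure.funMap (φ.onFunction (n := 2) (.add : ringFunc 2)) ![x, y] = x + y :=
  letI := valuedFieldStructure O
  h.map_onFunction (n := 2) (.add : ringFunc 2) ![x, y]

theorem funMap_mul (h : IsValuedFieldExpansion φ O) (x y : M) :
    Structure.funMap (φ.onFunction (n := 2) (.mul : ringFunc 2)) ![x, y] = x * y :=
  letI := valuedFieldStructure O
  h.map_onFunction (n := 2) (.mul : ringFunc 2) ![x, y]

theorem funMap_neg (h : IsValuedFieldExpansion φ O) (x : M) :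
    Structure.funMap (φ.onFunction (n := 1) (.neg : ringFunc 1)) ![x] = -x :=
  letI := valuedFieldStructure O
  h.map_onFunction (n := 1) (.neg : ringFunc 1) ![x]

theorem funMap_zero (h : IsValuedFieldExpansion φ O) :
    Structure.funMap (φ.onFunction (n := 0) (.zero : ringFunc 0)) ![] = (0 : M) :=
  letI := valuedFieldStructure O
  h.map_onFunction (n := 0) (.zero : ringFunc 0) ![]

theorem funMap_one (h : IsValuedFieldExpansion φ O) :
    Structure.funMap (φ.onFunction (n := 0) (.one : ringFunc 0)) ![] = (1 : M) :=
  letI := valuedFieldStructure O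
  h.map_onFunction (n := 0) (.one : ringFunc 0) ![]

theorem relMap_integer (h : IsValuedFieldExpansion φ O) (x : M) :
    Structure.RelMap (φ.onRelation (n := 1) (.integer : ValuedFieldRel 1)) ![x] ↔ x ∈ O :=
  letI := valuedFieldStructure O
  iff_of_eq (h.map_onRelation (n := 1) (.integer : ValuedFieldRel 1) ![x])

variable {f g : (α → M) → M}

theorem definableFun_add (h : IsValuedFieldExpansion φ O) (hf : A.DefinableFun L f)
    (hg : A.DefinableFun L g) : A.DefinableFun L fun v => f v + g v := by
  have := DefinableFun.comp (g := fun v => ![f v, g v])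
    (fun i => by fin_cases i; exacts [hf, hg])
    (DefinableFun.of_empty (A := A)
      (DefinableFun.fun_symbol (φ.onFunction (n := 2) (.add : ringFunc 2))))
  simpa only [h.funMap_add] using this

theorem definableFun_mul (h : IsValuedFieldExpansion φ O) (hf : A.DefinableFun L f)
    (hg : A.DefinableFun L g) : A.DefinableFun L fun v => f v * g v := by
  have := DefinableFun.comp (g := fun v => ![f v, g v])
    (fun i => by fin_cases i; exacts [hf, hg])
    (DefinableFun.of_empty (A := A)
      (DefinableFun.fun_symbol (φ.onFunction (n := 2) (.mul : ringFunc 2))))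
  simpa only [h.funMap_mul] using this

theorem definableFun_neg (h : IsValuedFieldExpansion φ O) (hf : A.DefinableFun L f) :
    A.DefinableFun L fun v => -f v := by
  have := DefinableFun.comp (g := fun v => ![f v])
    (fun i => by fin_cases i; exact hf)
    (DefinableFun.of_empty (A := A)
      (DefinableFun.fun_symbol (φ.onFunction (n := 1) (.neg : ringFunc 1))))
  simpa only [h.funMap_neg] using this

theorem definableFun_zero (h : IsValuedFieldExpansion φ O) :
    A.DefinableFun L fun _ : α → M => (0 : M) := by
  have := DefinableFun.comp (A := A) (g := fun _ : α → M => ![])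
    (fun i => i.elim0)
    (DefinableFun.of_empty (A := A)
      (DefinableFun.fun_symbol (φ.onFunction (n := 0) (.zero : ringFunc 0))))
  simpa only [h.funMap_zero] using this

theorem definableFun_one (h : IsValuedFieldExpansion φ O) :
    A.DefinableFun L fun _ : α → M => (1 : M) := by
  have := DefinableFun.comp (A := A) (g := fun _ : α → M => ![])
    (fun i => i.elim0)
    (DefinableFun.of_empty (A := A)
      (DefinableFun.fun_symbol (φ.onFunction (n := 0) (.one : ringFunc 0))))
  simpa only [h.funMap_one] using this

theorem definableFun_natCast (h : IsValuedFieldExpansion φ O) (n : ℕ) :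
    A.DefinableFun L fun _ : α → M => (n : M) := by
  induction n with
  | zero => simpa using h.definableFun_zero
  | succ n ih => simpa using h.definableFun_add ih h.definableFun_one

theorem definableFun_sub (h : IsValuedFieldExpansion φ O) (hf : A.DefinableFun L f)
    (hg : A.DefinableFun L g) : A.DefinableFun L fun v => f v - g v := by
  simpa only [sub_eq_add_neg] using h.definableFun_add hf (h.definableFun_neg hg)

theorem definable_mem (h : IsValuedFieldExpansion φ O) (hf : A.DefinableFun L f) :
    A.Definable L {v | f v ∈ O} := by
  refine Set.Definable.comp_one (S := (O : Set M)) ?_ hf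
  refine Set.Definable.mono (A := ∅) (empty_definable_iff.2
    ⟨(φ.onRelation (n := 1) (.integer : ValuedFieldRel 1)).formula ![Term.var 0], ?_⟩)
    (Set.empty_subset _)
  ext v
  have : (fun i => Term.realize v ((![Term.var 0] : Fin 1 → L.Term (Fin 1)) i)) = ![v 0] := by
    ext i; fin_cases i; rfl
  rw [Set.mem_ofPred_eq, Set.mem_ofPred_eq, Formula.realize_rel, this, h.relMap_integer]
  rfl

/-- The value group is not a sort; comparison of values is divisibility with quotient in `O`. -/
theorem definable_valuation_le (h : IsValuedFieldExpansion φ O) (hf : A.DefinableFun L f)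
    (hg : A.DefinableFun L g) : A.Definable L {v | O.valuation (f v) ≤ O.valuation (g v)} := by
  have key : A.Definable L
      {v : Fin 2 → M | O.valuation (v 0) ≤ O.valuation (v 1)} := by
    have : {v : Fin 2 → M | O.valuation (v 0) ≤ O.valuation (v 1)} =
        {v : Fin 2 → M | ∃ z, z ∈ O ∧ z * v 1 = v 0} := by
      ext v
      simp [O.valuation_le_iff]
    rw [this]
    exact Set.Definable.exists_one (P := fun z v => z ∈ O ∧ z * v 1 = v 0)
      ((h.definable_mem (DefinableFun.proj L)).and
        (DefinableFun.ofPred_eq (h.definableFun_mul (DefinableFun.proj L) (DefinableFun.proj L))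
          (DefinableFun.proj L)))
  exact key.comp_two (W := fun x y => O.valuation x ≤ O.valuation y) hf hg

theorem definable_rv_eq [CharZero M] (h : IsValuedFieldExpansion φ O) (n : ℕ+)
    (hf : A.DefinableFun L f) (hg : A.DefinableFun L g) :
    A.Definable L {v | rv O (natRadius O n) (f v) = rv O (natRadius O n) (g v)} := by
  simp only [rv_natRadius_eq_iff]
  exact ((hf.ofPred_eq h.definableFun_zero).and (hg.ofPred_eq h.definableFun_zero)).or
    (h.definable_valuation_le (h.definableFun_mul (h.definableFun_natCast _) hg)
      (h.definableFun_sub hf hg)).not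

end IsValuedFieldExpansion

end ValuedFieldDefinability

/-! ### Transfer of the valued field structure along elementary equivalence. -/

section Transfer

open FirstOrder.Language Set BoundedFormula FirstOrder.Ring

/-- The inclusion of the language of rings in the language of valued fields. -/
def ringToValuedField : FirstOrder.Language.ring →ᴸ valuedFieldLanguage where
  onFunction := fun {_} f => f
  onRelation := fun {_} r => nomatch r

variable {L : FirstOrder.Language.{u, v}} (φ : valuedFieldLanguage →ᴸ L)

/-- Sentences which say that the distinguished predicate is a valuation ring. -/
inductive ValuationRingAxiom : Type
  | one | add | mul | neg | inv

open ValuationRingAxiom in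
/-- The sentence of the axiom. -/
def ValuationRingAxiom.toSentence : ValuationRingAxiom → L.Sentence :=
  let R (k : ℕ) (t : L.Term (Empty ⊕ Fin k)) : L.BoundedFormula Empty k :=
    (φ.onRelation (n := 1) (.integer : ValuedFieldRel 1)).boundedFormula ![t]
  fun
  | one => R 0 (.func (φ.onFunction (n := 0) (.one : ringFunc 0)) ![])
  | add => ∀' ∀' (R 2 (&0) ⟹ R 2 (&1) ⟹
      R 2 (.func (φ.onFunction (n := 2) (.add : ringFunc 2)) ![&0, &1]))
  | mul => ∀' ∀' (R 2 (&0) ⟹ R 2 (&1) ⟹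
      R 2 (.func (φ.onFunction (n := 2) (.mul : ringFunc 2)) ![&0, &1]))
  | neg => ∀' (R 1 (&0) ⟹
      R 1 (.func (φ.onFunction (n := 1) (.neg : ringFunc 1)) ![&0]))
  | inv => ∀' (∼ (R 1 (&0)) ⟹ ∃' (R 2 (&1) ⊓
      (.equal (.func (φ.onFunction (n := 2) (.mul : ringFunc 2)) ![&0, &1])
        (.func (φ.onFunction (n := 0) (.one : ringFunc 0)) ![]))))

open ValuationRingAxiom in
/-- The statement of the axiom. -/
def ValuationRingAxiom.toProp {N : Type*} [Field N] (P : N → Prop) : ValuationRingAxiom → Prop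
  | one => P 1
  | add => ∀ x y, P x → P y → P (x + y)
  | mul => ∀ x y, P x → P y → P (x * y)
  | neg => ∀ x, P x → P (-x)
  | inv => ∀ x, ¬ P x → ∃ y, P y ∧ x * y = 1

theorem ValuationRingAxiom.realize_toSentence_iff {N : Type*} [Field N] [L.Structure N]
    {P : N → Prop}
    (hadd : ∀ F : Fin 2 → N,
      Structure.funMap (φ.onFunction (n := 2) (.add : ringFunc 2)) F = F 0 + F 1)
    (hmul : ∀ F : Fin 2 → N,
      Structure.funMap (φ.onFunction (n := 2) (.mul : ringFunc 2)) F = F 0 * F 1)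
    (hneg : ∀ F : Fin 1 → N,
      Structure.funMap (φ.onFunction (n := 1) (.neg : ringFunc 1)) F = -F 0)
    (hone : ∀ F : Fin 0 → N,
      Structure.funMap (φ.onFunction (n := 0) (.one : ringFunc 0)) F = 1)
    (hP : ∀ F : Fin 1 → N,
      Structure.RelMap (φ.onRelation (n := 1) (.integer : ValuedFieldRel 1)) F ↔ P (F 0))
    (a : ValuationRingAxiom) : N ⊨ a.toSentence φ ↔ a.toProp P := by
  cases a <;>
  simp [toSentence, toProp, Sentence.Realize, Formula.Realize, Relations.boundedFormula,
    BoundedFormula.Realize, Fin.snoc, hadd, hmul, hneg, hone, hP]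

/-- An elementarily equivalent structure of an expansion of a valued field is an expansion of a
valued field. -/
theorem IsValuedFieldExpansion.exists_of_elementarilyEquivalent {φ : valuedFieldLanguage →ᴸ L}
    {K : Type*} [Field K] [L.Structure K] {O : ValuationSubring K}
    (h : IsValuedFieldExpansion φ O) {N : Type*} [L.Structure N] (e : K ≅[L] N) :
    ∃ (_ : Field N) (O' : ValuationSubring N), IsValuedFieldExpansion φ O' := by
  let ψ : FirstOrder.Language.ring →ᴸ L := φ.comp ringToValuedField
  let := valuedFieldStructure O
  let : CompatibleRing K := compatibleRingOfRing K
  have hψK : ψ.IsExpansionOn K :=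
    ⟨fun {n} f x => (h.map_onFunction f x).trans (by cases f <;> rfl), fun r => nomatch r⟩
  let := ψ.reduct N
  have hf : Theory.field.Model N := ⟨fun θ hθ => by
    rw [← LHom.realize_onSentence (φ := ψ) N, ← e.realize_sentence, LHom.realize_onSentence]
    exact Theory.realize_sentence_of_mem _ hθ⟩
  let := Field.fieldOfModelField N
  let := Field.compatibleRingOfModelField N
  have hadd : ∀ F : Fin 2 → N, Structure.funMap (φ.onFunction (n := 2) (.add : ringFunc 2)) F =
    F 0 + F 1 := CompatibleRing.funMap_add
  have hmul : ∀ F : Fin 2 → N, Structure.funMap (φ.onFunction (n := 2) (.mul : ringFunc 2)) F =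
    F 0 * F 1 := CompatibleRing.funMap_mul
  have hneg : ∀ F : Fin 1 → N, Structure.funMap (φ.onFunction (n := 1) (.neg : ringFunc 1)) F =
    -F 0 := CompatibleRing.funMap_neg
  have hone : ∀ F : Fin 0 → N, Structure.funMap (φ.onFunction (n := 0) (.one : ringFunc 0)) F =
    1 := CompatibleRing.funMap_one
  have hzero : ∀ F : Fin 0 → N, Structure.funMap (φ.onFunction (n := 0) (.zero : ringFunc 0)) F =
    0 := CompatibleRing.funMap_zero
  let P : N → Prop := fun x =>
    Structure.RelMap (φ.onRelation (n := 1) (.integer : ValuedFieldRel 1)) ![x]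
  have hP : ∀ F : Fin 1 → N,
      Structure.RelMap (φ.onRelation (n := 1) (.integer : ValuedFieldRel 1)) F ↔ P (F 0) := by
    intro F
    have : F = ![F 0] := by ext i; fin_cases i; rfl
    rw [this]; rfl
  have ax : ∀ a : ValuationRingAxiom, a.toProp P := by
    intro a
    rw [← ValuationRingAxiom.realize_toSentence_iff φ hadd hmul hneg hone hP,
      ← e.realize_sentence, ValuationRingAxiom.realize_toSentence_iff φ (P := (· ∈ O))
        (fun F => h.map_onFunction (n := 2) (.add : ringFunc 2) F)
        (fun F => h.map_onFunction (n := 2) (.mul : ringFunc 2) F)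
        (fun F => h.map_onFunction (n := 1) (.neg : ringFunc 1) F)
        (fun F => h.map_onFunction (n := 0) (.one : ringFunc 0) F)
        (fun F => iff_of_eq (h.map_onRelation (n := 1) (.integer : ValuedFieldRel 1) F))]
    cases a with
    | one => exact O.one_mem
    | add => exact O.add_mem
    | mul => exact O.mul_mem
    | neg => exact O.neg_mem
    | inv =>
      intro x hx
      refine ⟨x⁻¹, (O.mem_or_inv_mem x).resolve_left hx, mul_inv_cancel₀ ?_⟩
      rintro rfl
      exact hx O.zero_mem
  refine ⟨inferInstance, ⟨⟨⟨⟨⟨{x | P x}, fun {x y} => ax .mul x y⟩, ax .one⟩,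
    fun {x y} => ax .add x y, ?_⟩, fun {x} => ax .neg x⟩, ?_⟩, ?_⟩
  -- No axiom speaks of `0`, which is obtained as `1 + (-1)`.
  · have := ax .add 1 (-1) (ax .one) (ax .neg 1 (ax .one))
    rwa [add_neg_cancel] at this
  · intro x
    by_cases hx : P x
    · exact Or.inl hx
    · obtain ⟨y, hy, hxy⟩ := ax .inv x hx
      rw [← eq_inv_of_mul_eq_one_right hxy]
      exact Or.inr hy
  · refine @LHom.IsExpansionOn.mk _ _ φ N (_) _ (fun {n} f x => ?_) (fun {n} r x => ?_)
    · cases f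
      exacts [hadd x, hmul x, hneg x, hzero x, hone x]
    · cases r
      exact propext (hP x)

end Transfer

/-! ### Parameter sets whose definable leading terms come from `R`. -/

section Control

open FirstOrder.Language Set

variable {L : FirstOrder.Language.{u, v}} {φ : valuedFieldLanguage →ᴸ L} {M : Type w} [Field M]
  [CharZero M] [L.Structure M] {O : ValuationSubring M} {A R : Set M}

variable (L O) in
/-- Every unary set which is definable over the leading term structures is prepared by a finite
set. -/
def HasFinitePreparation : Prop :=
  ∀ (n : ℕ+) (A X : Set M), IsDefinableOverRV O L A (natRadius O n) X →
    ∃ (m : ℕ+) (C : Set M), C.Finite ∧ A.Definable₁ L C ∧ IsPreparedBy O (natRadius O m) X C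

variable (L O) in
/-- The parameter set `A` contains `R` and, in each leading term structure `RV_{|n|}`, every
nonempty `A`-definable set contains the leading term of an element of `R`. -/
structure IsRVControlled (R A : Set M) : Prop where
  subset : R ⊆ A
  meets : ∀ (n : ℕ+) (Y : Set M), A.Definable₁ L Y →
    (∀ y y', rv O (natRadius O n) y = rv O (natRadius O n) y' → y ∈ Y → y' ∈ Y) →
    Y.Nonempty → (Y ∩ R).Nonempty

namespace IsRVControlled

/-- A definition uses finitely many parameters, which lie in one member of the chain. -/
theorem sUnion {c : Set (Set M)} (hc : IsChain (· ⊆ ·) c) (hne : c.Nonempty)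
    (h : ∀ A ∈ c, IsRVControlled L O R A) : IsRVControlled L O R (⋃₀ c) := by
  obtain ⟨A, hA⟩ := hne
  refine ⟨(h A hA).subset.trans (subset_sUnion_of_mem hA), fun n Y hY hinv hY0 => ?_⟩
  obtain ⟨F, hF, hFY⟩ := definable_iff_finitely_definable.1 hY
  obtain ⟨B, hB, hFB⟩ :=
    hc.directedOn.exists_mem_subset_of_finite_of_subset_sUnion ⟨A, hA⟩ F.finite_toSet hF
  exact (h B hB).meets n Y (hFY.mono hFB) hinv hY0

theorem exists_maximal (h : IsRVControlled L O R A) :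
    ∃ B, A ⊆ B ∧ Maximal (IsRVControlled L O R) B :=
  zorn_subset_nonempty {B | IsRVControlled L O R B}
    (fun c hc hchain hne => ⟨⋃₀ c, sUnion hchain hne fun _ hB => hc hB,
      fun _ => subset_sUnion_of_mem⟩) A h

/-- Elements of a finite definable set can be adjoined to a controlled set. -/
theorem insert_of_mem_finite (hφ : IsValuedFieldExpansion φ O)
    (h : IsRVControlled L O R A) {C : Set M} (hfin : C.Finite)
    (hC : A.Definable₁ L C) {c : M} (hc : c ∈ C) : IsRVControlled L O R (insert c A) := by
  obtain ⟨D, ⟨hDfin, hD, hcD⟩, hmin⟩ := (measure (Set.ncard (α := M))).wf.has_min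
    {D : Set M | D.Finite ∧ A.Definable₁ L D ∧ c ∈ D} ⟨C, hfin, hC, hc⟩
  -- Minimality of `D`: an `A`-definable property of one element of `D` also holds of `c`.
  have orbit : ∀ D' : Set M, A.Definable₁ L D' → (D ∩ D').Nonempty → c ∈ D' := by
    rintro D' hD' ⟨d, hdD, hdD'⟩
    by_contra hcD'
    have hlt : (D \ D').ncard < D.ncard :=
      ncard_lt_ncard ⟨sdiff_subset, fun hle => (hle hdD).2 hdD'⟩ hDfin
    exact hmin (D \ D') ⟨hDfin.subset sdiff_subset, hD.sdiff hD', hcD, hcD'⟩ hlt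
  refine ⟨h.subset.trans (subset_insert _ _), fun n Y hY hinv hne => ?_⟩
  obtain ⟨W, hW, rfl⟩ := hY.exists_fibre
  obtain ⟨y₀, hy₀⟩ := hne
  -- Requiring `W x` on a whole leading term fibre gives an invariant set for every `x`, whereas `W
  -- x` itself is known to be invariant only for `x = c`.
  have hsat : A.Definable L
      {v : Fin 2 → M | ∀ t, rv O (natRadius O n) t = rv O (natRadius O n) (v 1) → W (v 0) t} :=
    .forall_one (P := fun t (v : Fin 2 → M) =>
        rv O (natRadius O n) t = rv O (natRadius O n) (v 1) → W (v 0) t)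
      ((hφ.definable_rv_eq n (.proj L) (.proj L)).imp (hW.comp_two (.proj L) (.proj L)))
  obtain ⟨b, ⟨x, hxD, hxb⟩, hbR⟩ := h.meets n
    {y | ∃ x, x ∈ D ∧ ∀ t, rv O (natRadius O n) t = rv O (natRadius O n) y → W x t}
    (.exists_one (P := fun x (v : Fin 1 → M) =>
        x ∈ D ∧ ∀ t, rv O (natRadius O n) t = rv O (natRadius O n) (v 0) → W x t)
      ((Definable.comp_one hD (.proj L)).and
        (hsat.comp_two (W := fun x y => ∀ t, rv O (natRadius O n) t = rv O (natRadius O n) y →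
          W x t) (.proj L) (.proj L))))
    (fun y y' hyy' ⟨x, hx, hxt⟩ => ⟨x, hx, fun t ht => hxt t (ht.trans hyy'.symm)⟩)
    ⟨y₀, c, hcD, fun t ht => hinv y₀ t ht.symm hy₀⟩
  refine ⟨b, ?_, hbR⟩
  exact orbit {x | ∀ t, rv O (natRadius O n) t = rv O (natRadius O n) b → W x t}
    (hsat.comp_two (W := fun x y => ∀ t, rv O (natRadius O n) t = rv O (natRadius O n) y →
          W x t) (.proj L) (L.definableFun_const _ (h.subset hbR))) ⟨x, hxD, hxb⟩ b rfl

/-- A maximal controlled set is algebraically closed in the model-theoretic sense. -/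
theorem mem_of_maximal (hφ : IsValuedFieldExpansion φ O) (hA : Maximal (IsRVControlled L O R) A)
    {C : Set M} (hfin : C.Finite) (hC : A.Definable₁ L C) : C ⊆ A := fun _ hc =>
  hA.le_of_ge (hA.prop.insert_of_mem_finite hφ hfin hC hc) (subset_insert _ _) (mem_insert _ _)

/-- Around the centre nearest to one of its points, a prepared set contains a whole leading term
fibre. The definable set of such fibres contains the leading term of some `b ∈ R`, and `c + b` lies
in `A` by maximality. -/
theorem meetsDefinable_of_maximal (hφ : IsValuedFieldExpansion φ O)
    (hprep : HasFinitePreparation L O) (hA : Maximal (IsRVControlled L O R) A) :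
    L.MeetsDefinable A := by
  rintro X ⟨x, hx⟩ hX
  obtain ⟨m, C, hCfin, hC, hXC⟩ := hprep 1 A X
    ⟨0, {p | p.1 ∈ X}, Fin.elim0, hX, rfl⟩
  have hCA : C ⊆ A := mem_of_maximal hφ hA hCfin hC
  have hzero : (0 : M) ∈ A := mem_of_maximal hφ hA (finite_singleton 0)
    (DefinableFun.ofPred_eq (.proj L) hφ.definableFun_zero) rfl
  rcases C.eq_empty_or_nonempty with rfl | hCne
  · exact ⟨0, (hXC x 0 (by simp)).1 hx, hzero⟩
  -- For the nearest centre `c`, every `|x - d|` is at least `|x - c|`, so `rv(x - c)` determines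
  -- `rv(x - d)`.
  obtain ⟨c, hcC, hmin⟩ := exists_min_image C (fun c => O.valuation (x - c)) hCfin hCne
  have hfib : ∀ x', rv O (natRadius O m) (x' - c) = rv O (natRadius O m) (x - c) → x' ∈ X := by
    intro x' hx'
    refine (hXC x x' fun d hd => ?_).1 hx
    rw [eq_comm, rv_eq_rv_iff]
    rcases rv_eq_rv_iff.1 hx' with ⟨h0, h0'⟩ | hlt
    · rw [sub_eq_zero] at h0 h0'
      subst h0
      subst h0'
      by_cases hxd : x = d
      · simp [hxd]
      · right
        simp only [sub_self, map_zero]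
        exact mul_pos (natRadius O m).2.1 ((Valuation.pos_iff _).2 (sub_ne_zero.2 hxd))
    · right
      rw [sub_sub_sub_cancel_right] at hlt ⊢
      exact hlt.trans_le (mul_le_mul_right (hmin d hd) _)
  obtain ⟨b, hb, hbR⟩ := hA.prop.meets m
    {y | ∀ t, rv O (natRadius O m) t = rv O (natRadius O m) y → c + t ∈ X}
    (.forall_one (P := fun t (v : Fin 1 → M) =>
        rv O (natRadius O m) t = rv O (natRadius O m) (v 0) → c + t ∈ X)
      ((hφ.definable_rv_eq m (.proj L) (.proj L)).imp (Definable.comp_one hX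
        (hφ.definableFun_add (L.definableFun_const _ (hCA hcC)) (.proj L)))))
    (fun y y' hyy' hy t ht => hy t (ht.trans hyy'.symm))
    ⟨x - c, fun t ht => hfib _ (by simpa using ht)⟩
  refine ⟨c + b, hb b rfl, ?_⟩
  exact mem_of_maximal hφ hA (finite_singleton (c + b))
    (DefinableFun.ofPred_eq (.proj L) (hφ.definableFun_add
      (L.definableFun_const _ (hCA hcC)) (L.definableFun_const _ (hA.prop.subset hbR)))) rfl

end IsRVControlled

/-- A common point of a chain of definable sets on which all leading terms `rv_{|m|}(x - c)` are
eventually constant can be adjoined to an elementary substructure `R`. -/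
theorem IsRVControlled.insert_of_mem_chain (hφ : IsValuedFieldExpansion φ O)
    (hprep : HasFinitePreparation L O) (hR : L.MeetsDefinable R) {𝓓 : Set (Set M)}
    (hne : 𝓓.Nonempty) (hchain : IsChain (· ⊆ ·) 𝓓) (hdef : ∀ B ∈ 𝓓, R.Definable₁ L B)
    (hsmall : ∀ c ∈ R, ∀ m : ℕ+, ∃ B ∈ 𝓓, ∀ x ∈ B, ∀ x' ∈ B,
      rv O (natRadius O m) (x - c) = rv O (natRadius O m) (x' - c))
    {a : M} (ha : ∀ B ∈ 𝓓, a ∈ B) : IsRVControlled L O R (insert a R) := by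
  refine ⟨subset_insert _ _, fun n Y hY hinv ⟨y₀, hy₀⟩ => ?_⟩
  obtain ⟨W, hW, rfl⟩ := hY.exists_fibre
  -- Only the leading term of `y₀` enters, so the preparing set is definable over `R` alone.
  have hX : IsDefinableOverRV O L R (natRadius O n)
      {x | ∀ t, rv O (natRadius O n) t = rv O (natRadius O n) y₀ → W x t} := by
    refine ⟨1, {p | ∀ t, rv O (natRadius O n) t = p.2 0 → W p.1 t},
      fun _ => rv O (natRadius O n) y₀, ?_, rfl⟩
    exact .forall_one (P := fun t (v : Fin 2 → M) =>
        rv O (natRadius O n) t = rv O (natRadius O n) (v 1) → W (v 0) t)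
      ((hφ.definable_rv_eq n (.proj L) (.proj L)).imp (hW.comp_two (.proj L) (.proj L)))
  obtain ⟨m, C, hCfin, hC, hXC⟩ := hprep n R _ hX
  have hCR : C ⊆ R := hR.subset_of_finite hCfin hC
  -- The smallest of finitely many members of the chain serves all centres.
  have hB : ∃ B ∈ 𝓓, ∀ c ∈ C, ∀ x ∈ B, ∀ x' ∈ B,
      rv O (natRadius O m) (x - c) = rv O (natRadius O m) (x' - c) := by
    clear hXC hC
    induction C, hCfin using Set.Finite.induction_on with
    | empty => exact ⟨_, hne.some_mem, by simp⟩
    | @insert c C _ _ ih =>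
      obtain ⟨B, hB, hBC⟩ := ih ((subset_insert _ _).trans hCR)
      obtain ⟨B', hB', hBc⟩ := hsmall c (hCR (mem_insert _ _)) m
      rcases hchain.total hB hB' with hle | hle
      · refine ⟨B, hB, fun d hd x hx x' hx' => ?_⟩
        rcases hd with rfl | hd
        exacts [hBc x (hle hx) x' (hle hx'), hBC d hd x hx x' hx']
      · refine ⟨B', hB', fun d hd x hx x' hx' => ?_⟩
        rcases hd with rfl | hd
        exacts [hBc x hx x' hx', hBC d hd x (hle hx) x' (hle hx')]
  obtain ⟨B, hB, hBC⟩ := hB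
  have hBX : ∀ x ∈ B, W x y₀ := fun x hx =>
    (hXC a x fun c hc => hBC c hc a (ha B hB) x hx).1 (fun t ht => hinv y₀ t ht.symm hy₀) y₀ rfl
  -- Quantifying over `B` eliminates `a`: the set is `R`-definable.
  obtain ⟨b, hb, hbR⟩ := hR {y | ∀ x, x ∈ B → W x y} ⟨y₀, hBX⟩
    (.forall_one (P := fun x (v : Fin 1 → M) => x ∈ B → W x (v 0))
      ((Definable.comp_one (hdef B hB) (.proj L)).imp (hW.comp_two (.proj L) (.proj L))))
  exact ⟨b, hb a (ha B hB), hbR⟩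

end Control

/-! ### Elementary embeddings, and realising a chain of sets. -/

section ElementaryExtension

open FirstOrder.Language Set BoundedFormula

variable {L : FirstOrder.Language.{u, v}} {φ : valuedFieldLanguage →ᴸ L}

/-- After replacing the parameters by preimages, the existential formula can be solved in `N`. -/
theorem FirstOrder.Language.ElementaryEmbedding.meetsDefinable_range {N M : Type*} [L.Structure N]
    [L.Structure M] (j : N ↪ₑ[L] M) : L.MeetsDefinable (range j) := by
  rintro D ⟨x, hx⟩ hD
  obtain ⟨θ, hθ⟩ := definable_iff_exists_formula_sum.1 hD
  have hmem : ∀ y, y ∈ D ↔ θ.Realize (Sum.elim (↑) fun _ : Fin 1 => y) := fun y => by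
    change (fun _ : Fin 1 => y) ∈ {v : Fin 1 → M | v 0 ∈ D} ↔ _
    rw [hθ]; rfl
  choose g hg using fun a : range j => a.2
  let θ' : L.Formula (N ⊕ Fin 1) := θ.relabel (Sum.map g id)
  have hθ' : ∀ y : Fin 1 → M, θ'.Realize (Sum.elim j y) ↔ y 0 ∈ D := fun y => by
    rw [hmem, Formula.realize_relabel]
    refine iff_of_eq (congrArg _ ?_)
    ext i
    rcases i with a | i
    · exact hg a
    · simp [Subsingleton.elim i 0]
  have h1 : (θ'.iExs (Fin 1)).Realize (j ∘ id) := by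
    rw [Formula.realize_iExs]
    exact ⟨fun _ => x, (hθ' _).2 hx⟩
  rw [j.map_formula, Formula.realize_iExs] at h1
  obtain ⟨y, hy⟩ := h1
  refine ⟨j (y 0), (hθ' (j ∘ y)).1 ?_, mem_range_self _⟩
  rw [← j.map_formula] at hy
  convert hy using 1
  ext i
  rcases i with a | i <;> rfl

/-- In an elementary extension, a point can be found in all members of a chain of nonempty sets:
it satisfies all formulas which hold throughout a member. -/
theorem exists_elementaryEmbedding_of_chain {N : Type w} [L.Structure N] {𝓑 : Set (Set N)}
    (h𝓑 : 𝓑.Nonempty) (hchain : IsChain (· ⊆ ·) 𝓑) (hne : ∀ B ∈ 𝓑, B.Nonempty) :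
    ∃ (M : Type w) (_ : L.Structure M) (j : N ↪ₑ[L] M) (a : M),
      ∀ (n : ℕ) (θ : L.Formula (Fin (n + 1))) (p : Fin n → N), ∀ B ∈ 𝓑,
        (∀ x ∈ B, θ.Realize (Fin.cons x p : Fin (n + 1) → N)) →
          θ.Realize (Fin.cons a (j ∘ p) : Fin (n + 1) → M) := by
  have : Nonempty 𝓑 := h𝓑.to_subtype
  have : IsCodirectedOrder 𝓑 := ⟨fun a b => (hchain.total a.2 b.2).elim
    (fun h => ⟨a, le_rfl, h⟩) (fun h => ⟨b, h, le_rfl⟩)⟩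
  -- `U` contains all initial segments `{B' | B' ⊆ B}`, so the class of a choice function lies in
  -- every `B`.
  let U : Ultrafilter 𝓑 := Ultrafilter.of Filter.atBot
  have : Nonempty N := (hne _ h𝓑.some_mem).to_subtype.map Subtype.val
  let M := (U : Filter 𝓑).Product fun _ : 𝓑 => N
  let j : N ↪ₑ[L] M := ⟨fun x => ((fun _ => x : 𝓑 → N) : M), fun n θ x => by
    refine (Ultraproduct.realize_formula_cast θ (fun i _ => x i)).trans ?_
    simp⟩
  refine ⟨M, inferInstance, j, ((fun B => (hne B.1 B.2).some : 𝓑 → N) : M),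
    fun n θ p B hB hθ => ?_⟩
  have h1 := (Ultraproduct.realize_formula_cast (u := U) (M := fun _ : 𝓑 => N) θ
    (Fin.cons (fun B => (hne B.1 B.2).some) (fun i _ => p i))).2 (by
      have : Set.Iic (⟨B, hB⟩ : 𝓑) ∈ (U : Filter 𝓑) :=
        Ultrafilter.of_le _ (Filter.Iic_mem_atBot _)
      filter_upwards [this] with B' hB'
      have := hθ (hne B'.1 B'.2).some (hB' (hne B'.1 B'.2).some_mem)
      convert this using 1
      ext i
      refine Fin.cases rfl (fun _ => rfl) i)
  refine (iff_of_eq (congrArg _ ?_)).1 h1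
  funext i
  refine Fin.cases rfl (fun _ => rfl) i

variable (φ) in
/-- The formula `|x₀ - x₁| ≤ |x₂ - x₃|`. -/
def valuationSubLE : L.Formula (Fin 4) :=
  let R (t : L.Term (Fin 4 ⊕ Fin 1)) : L.BoundedFormula (Fin 4) 1 :=
    (φ.onRelation (n := 1) (.integer : ValuedFieldRel 1)).boundedFormula ![t]
  let sub (s t : L.Term (Fin 4 ⊕ Fin 1)) : L.Term (Fin 4 ⊕ Fin 1) :=
    .func (φ.onFunction (n := 2) (.add : ringFunc 2))
      ![s, .func (φ.onFunction (n := 1) (.neg : ringFunc 1)) ![t] ]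
  let x (i : Fin 4) : L.Term (Fin 4 ⊕ Fin 1) := .var (Sum.inl i)
  ∃' (R (&0) ⊓ (.equal (.func (φ.onFunction (n := 2) (.mul : ringFunc 2))
    ![&0, sub (x 2) (x 3)]) (sub (x 0) (x 1))))

theorem IsValuedFieldExpansion.realize_valuationSubLE {N : Type*} [Field N] [L.Structure N]
    {O : ValuationSubring N} (h : IsValuedFieldExpansion φ O) (x : Fin 4 → N) :
    (valuationSubLE φ).Realize x ↔ O.valuation (x 0 - x 1) ≤ O.valuation (x 2 - x 3) := by
  have hadd : ∀ F : Fin 2 → N, Structure.funMap (φ.onFunction (n := 2) (.add : ringFunc 2)) F =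
    F 0 + F 1 := fun F => h.map_onFunction (n := 2) (.add : ringFunc 2) F
  have hmul : ∀ F : Fin 2 → N, Structure.funMap (φ.onFunction (n := 2) (.mul : ringFunc 2)) F =
    F 0 * F 1 := fun F => h.map_onFunction (n := 2) (.mul : ringFunc 2) F
  have hneg : ∀ F : Fin 1 → N, Structure.funMap (φ.onFunction (n := 1) (.neg : ringFunc 1)) F =
    -F 0 := fun F => h.map_onFunction (n := 1) (.neg : ringFunc 1) F
  have hP : ∀ F : Fin 1 → N, Structure.RelMap (φ.onRelation (n := 1)
      (.integer : ValuedFieldRel 1)) F ↔ F 0 ∈ O :=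
    fun F => iff_of_eq (h.map_onRelation (n := 1) (.integer : ValuedFieldRel 1) F)
  rw [O.valuation_le_iff]
  simp [valuationSubLE, Formula.Realize, Relations.boundedFormula, BoundedFormula.Realize,
    Fin.snoc, hadd, hmul, hneg, hP, sub_eq_add_neg]

section Embedding

variable {N M : Type*} [Field N] [L.Structure N] [Field M] [L.Structure M]
  {O : ValuationSubring N} {O' : ValuationSubring M}

/-- An elementary embedding of expansions of valued fields is a ring homomorphism. -/
def FirstOrder.Language.ElementaryEmbedding.toRingHom (j : N ↪ₑ[L] M)
    (h : IsValuedFieldExpansion φ O) (h' : IsValuedFieldExpansion φ O') : N →+* M where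
  toFun := j
  map_one' := by
    rw [← h.funMap_one, ← h'.funMap_one, j.map_fun]
    exact congrArg _ (Subsingleton.elim _ _)
  map_zero' := by
    rw [← h.funMap_zero, ← h'.funMap_zero, j.map_fun]
    exact congrArg _ (Subsingleton.elim _ _)
  map_add' x y := by
    rw [← h.funMap_add, ← h'.funMap_add, j.map_fun]
    exact congrArg _ (by ext i; fin_cases i <;> rfl)
  map_mul' x y := by
    rw [← h.funMap_mul, ← h'.funMap_mul, j.map_fun]
    exact congrArg _ (by ext i; fin_cases i <;> rfl)

theorem FirstOrder.Language.ElementaryEmbedding.comap_toRingHom (j : N ↪ₑ[L] M)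
    (h : IsValuedFieldExpansion φ O) (h' : IsValuedFieldExpansion φ O') :
    O'.comap (j.toRingHom h h') = O := by
  ext x
  change j x ∈ O' ↔ x ∈ O
  rw [← h.relMap_integer, ← h'.relMap_integer, ← j.map_rel]
  exact iff_of_eq (congrArg _ (by ext i; fin_cases i; rfl))

theorem valuation_map_le_iff_of_comap_eq {i : N →+* M} (hi : O'.comap i = O) {x y : N} :
    O'.valuation (i x) ≤ O'.valuation (i y) ↔ O.valuation x ≤ O.valuation y := by
  by_cases hy : y = 0
  · simp [hy]
  have h1 : O.valuation y ≠ 0 := (Valuation.ne_zero_iff _).2 hy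
  have h2 : O'.valuation (i y) ≠ 0 := (Valuation.ne_zero_iff _).2 ((map_ne_zero i).2 hy)
  rw [← div_le_one₀ (zero_lt_iff.2 h1), ← div_le_one₀ (zero_lt_iff.2 h2), ← map_div₀, ← map_div₀,
    ← map_div₀, O.valuation_le_one_iff, O'.valuation_le_one_iff, ← hi]
  rfl

end Embedding

end ElementaryExtension

/-! ### Leading terms on chains of balls. -/

section Balls

variable {K : Type w} [Field K] {O : ValuationSubring K}

theorem IsValuativeBall.nonempty {B : Set K} (hB : IsValuativeBall O B) : B.Nonempty := by
  obtain ⟨a, r, hr, rfl | rfl⟩ := hB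
  · exact ⟨a, by simpa using zero_lt_iff.2 hr⟩
  · exact ⟨a, by simp⟩

/-- By the ultrametric inequality any point is a centre. This form treats open and closed balls
alike and avoids the radius. -/
theorem IsValuativeBall.mem_of_valuation_sub_le {B : Set K} (hB : IsValuativeBall O B)
    {x y x' y' : K} (hy : y ∈ B) (hx' : x' ∈ B) (hy' : y' ∈ B)
    (h : O.valuation (x - y) ≤ O.valuation (x' - y')) : x ∈ B := by
  obtain ⟨a, r, -, rfl | rfl⟩ := hB
  · have h1 : O.valuation (x' - y') < r := by
      rw [← sub_sub_sub_cancel_right x' y' a]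
      exact O.valuation.map_sub_lt hx' hy'
    have := O.valuation.map_add_lt (h.trans_lt h1) hy
    rwa [sub_add_sub_cancel] at this
  · have h1 : O.valuation (x' - y') ≤ r := by
      rw [← sub_sub_sub_cancel_right x' y' a]
      exact O.valuation.map_sub_le hx' hy'
    have := O.valuation.map_add_le (h.trans h1) hy
    rwa [sub_add_sub_cancel] at this

/-- On a chain of balls without common point the leading terms `rv_{|m|}(x - c)` are eventually
constant, if only finitely many values lie between `|m|` and `1`. -/
theorem exists_ball_rv_sub_eq [CharZero K] {𝓑 : Set (Set K)} (hball : ∀ B ∈ 𝓑, IsValuativeBall O B)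
    (hchain : IsChain (· ⊆ ·) 𝓑) (hempty : ⋂₀ 𝓑 = ∅) (m : ℕ+)
    (hfin : (Set.Icc (O.valuation ((m : ℕ) : K)) 1).Finite) (c : K) :
    ∃ B ∈ 𝓑, ∀ x ∈ B, ∀ x' ∈ B,
      rv O (natRadius O m) (x - c) = rv O (natRadius O m) (x' - c) := by
  have hnot : ∀ x, ∃ B ∈ 𝓑, x ∉ B := fun x => by
    by_contra! hx
    exact (Set.eq_empty_iff_forall_notMem.1 hempty x) (Set.mem_sInter.2 hx)
  obtain ⟨B₀, hB₀, hcB₀⟩ := hnot c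
  obtain ⟨e, he⟩ := (hball B₀ hB₀).nonempty
  set ρ := O.valuation (e - c) with hρ
  set μ := O.valuation ((m : ℕ) : K) with hμ
  have hlt : ∀ x ∈ B₀, ∀ x' ∈ B₀, O.valuation (x - x') < ρ := fun x hx x' hx' => by
    by_contra! hle
    refine hcB₀ ((hball B₀ hB₀).mem_of_valuation_sub_le he hx hx' ?_)
    rwa [Valuation.map_sub_swap]
  have hval : ∀ x ∈ B₀, O.valuation (x - c) = ρ := fun x hx => by
    rw [← sub_add_sub_cancel x e c]
    exact O.valuation.map_add_eq_of_lt_right (hlt x hx e he)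
  by_contra! hbad
  -- On `B₀` the value of `x - c` is constantly `ρ`, so differing leading terms mean a distance at
  -- least `μ * ρ`.
  have hfar : ∀ B ∈ 𝓑, B ⊆ B₀ → ∃ x ∈ B, ∃ x' ∈ B, μ * ρ ≤ O.valuation (x - x') := by
    intro B hB hBB₀
    obtain ⟨x, hx, x', hx', hne⟩ := hbad B hB
    refine ⟨x, hx, x', hx', ?_⟩
    by_contra! hlt'
    refine hne (rv_eq_rv_iff.2 (Or.inr ?_))
    rw [sub_sub_sub_cancel_right, hval x' (hBB₀ hx')]
    exact hlt'
  let D (B : Set K) : Set O.ValueGroup :=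
    {γ | γ ∈ Set.Icc (μ * ρ) ρ ∧ ∃ x ∈ B, ∃ x' ∈ B, O.valuation (x - x') = γ}
  have hρ0 : 0 < ρ := lt_of_le_of_lt zero_le (hlt e he e he)
  have hDfin : ∀ B, (D B).Finite := fun B => by
    refine (hfin.image (· * ρ)).subset ?_
    rintro γ ⟨⟨h1, h2⟩, -⟩
    exact ⟨γ / ρ, ⟨(le_div_iff₀ hρ0).2 h1, (div_le_one₀ hρ0).2 h2⟩, div_mul_cancel₀ _ hρ0.ne'⟩
  -- Each strictly smaller ball loses a distance in `[μρ, ρ]`: from a removed point to a remaining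
  -- one is farther than any distance within the smaller ball. Finiteness stops this.
  obtain ⟨B, ⟨hB, hBB₀⟩, hmin⟩ := (measure fun B => (D B).ncard).wf.has_min
    {B | B ∈ 𝓑 ∧ B ⊆ B₀} ⟨B₀, hB₀, subset_rfl⟩
  obtain ⟨b, hb⟩ := (hball B hB).nonempty
  obtain ⟨B', hB', x, hxB, hxB'⟩ : ∃ B' ∈ 𝓑, ∃ x ∈ B, x ∉ B' := by
    obtain ⟨B', hB', hb'⟩ := hnot b
    exact ⟨B', hB', b, hb, hb'⟩
  have hsub : B' ⊆ B := (hchain.total hB' hB).resolve_right fun h => hxB' (h hxB)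
  obtain ⟨y, hy, y', hy', hfar'⟩ := hfar B' hB' (hsub.trans hBB₀)
  refine hmin B' ⟨hB', hsub.trans hBB₀⟩ (Set.ncard_lt_ncard ⟨?_, fun hle => ?_⟩ (hDfin B))
  · rintro γ ⟨hγ, x₁, h₁, x₂, h₂, h⟩
    exact ⟨hγ, x₁, hsub h₁, x₂, hsub h₂, h⟩
  · have hgt : O.valuation (y - y') < O.valuation (x - y) := by
      by_contra! hle'
      exact hxB' ((hball B' hB').mem_of_valuation_sub_le hy hy hy' hle')
    have hmem : O.valuation (x - y) ∈ D B :=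
      ⟨⟨hfar'.trans hgt.le, (hlt x (hBB₀ hxB) y (hBB₀ (hsub hy))).le⟩, x, hxB, y, hsub hy, rfl⟩
    obtain ⟨-, x₁, h₁, x₂, h₂, h⟩ := hle hmem
    exact hxB' ((hball B' hB').mem_of_valuation_sub_le hy h₁ h₂ h.ge)

end Balls

/-! ### Immediate elementary extensions. -/

section ImmediateExtension

open FirstOrder.Language Set

variable {L : FirstOrder.Language.{u, v}} {φ : valuedFieldLanguage →ᴸ L}

variable (φ) in
/-- Every element of `N` other than `0` has the same leading term as an element of `K`. -/
def IsImmediateEmbedding {K N : Type*} [Zero K] [L.Structure K] [L.Structure N]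
    (j : K ↪ₑ[L] N) : Prop :=
  ∀ y, y ≠ j 0 → ∃ x, ¬ (valuationSubLE φ).Realize ![y, j 0, y, j x]

/-- Phrasing immediacy by a formula lets it apply to bare `L`-structures, before a field structure
on `N` is chosen. -/
theorem isImmediateEmbedding_iff {K N : Type*} [Field K] [L.Structure K] [Field N] [L.Structure N]
    {O : ValuationSubring K} {O' : ValuationSubring N} (hK : IsValuedFieldExpansion φ O)
    (hN : IsValuedFieldExpansion φ O') (j : K ↪ₑ[L] N) :
    IsImmediateEmbedding φ j ↔ ∀ y ≠ 0, ∃ x, O'.valuation (y - j x) < O'.valuation y := by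
  have h0 : j 0 = 0 := map_zero (j.toRingHom hK hN)
  simp [IsImmediateEmbedding, h0, hN.realize_valuationSubLE]

/-- From `|y - x| < |y|` follows `|x| = |y|`; when `|y| = 1`, `x` also has the residue of `y`. -/
theorem IsImmediateEmbedding.isImmediateExtension {K N : Type*} [Field K] [L.Structure K] [Field N]
    [L.Structure N] {O : ValuationSubring K} {O' : ValuationSubring N}
    (hK : IsValuedFieldExpansion φ O) (hN : IsValuedFieldExpansion φ O') {j : K ↪ₑ[L] N}
    (hj : IsImmediateEmbedding φ j) : IsImmediateExtension O O' (j.toRingHom hK hN) := by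
  rw [isImmediateEmbedding_iff hK hN] at hj
  have hcomap := j.comap_toRingHom hK hN
  refine ⟨hcomap, fun y => ?_, fun y hy => ?_⟩
  · by_cases hy : y = 0
    · exact ⟨0, by simp [hy]⟩
    · obtain ⟨x, hx⟩ := hj y hy
      refine ⟨x, ?_⟩
      have := O'.valuation.map_sub_eq_of_lt_left hx
      rwa [sub_sub_cancel] at this
  · rcases (O'.valuation_le_one_iff y).2 hy |>.lt_or_eq with hlt | heq
    · exact ⟨0, O.zero_mem, by simpa using hlt⟩
    · obtain ⟨x, hx⟩ := hj y (by rintro rfl; simp at heq)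
      refine ⟨x, ?_, hx.trans_eq heq⟩
      have := O'.valuation.map_sub_eq_of_lt_left hx
      rw [sub_sub_cancel] at this
      rw [← hcomap]
      exact (O'.valuation_le_one_iff _).1 (this.trans heq).le

theorem IsImmediateEmbedding.comp {K N P : Type*} [Field K] [L.Structure K] [Field N]
    [L.Structure N] [L.Structure P] {O : ValuationSubring K} {O' : ValuationSubring N}
    (hK : IsValuedFieldExpansion φ O) (hN : IsValuedFieldExpansion φ O') {j : K ↪ₑ[L] N}
    {k : N ↪ₑ[L] P} (hk : IsImmediateEmbedding φ k) (hj : IsImmediateEmbedding φ j) :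
    IsImmediateEmbedding φ (k.comp j) := by
  obtain ⟨_, O'', hP⟩ := hN.exists_of_elementarilyEquivalent k.elementarilyEquivalent
  rw [isImmediateEmbedding_iff hN hP] at hk
  rw [isImmediateEmbedding_iff hK hN] at hj
  rw [isImmediateEmbedding_iff hK hP]
  intro z hz
  obtain ⟨y, hy⟩ := hk z hz
  have hzy := O''.valuation.map_sub_eq_of_lt_left hy
  rw [sub_sub_cancel] at hzy
  have hy0 : y ≠ 0 := by
    rintro rfl
    have : k 0 = 0 := map_zero (k.toRingHom hN hP)
    simp [this] at hy
  obtain ⟨x, hx⟩ := hj y hy0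
  refine ⟨x, ?_⟩
  have hx' : O''.valuation (k (y - j x)) < O''.valuation (k y) := by
    rw [← not_le] at hx ⊢
    rwa [← valuation_map_le_iff_of_comap_eq (k.comap_toRingHom hN hP)] at hx
  have hmap : k (y - j x) = k y - k (j x) := map_sub (k.toRingHom hN hP) _ _
  rw [hmap, hzy] at hx'
  have := O''.valuation.map_add_lt hy hx'
  rwa [sub_add_sub_cancel] at this

/-- If `N` is not spherically complete, then it has a proper immediate elementary extension. -/
theorem exists_isImmediateEmbedding_not_surjective {N : Type w} [Field N] [CharZero N]
    [L.Structure N] {O : ValuationSubring N} (hN : IsValuedFieldExpansion φ O)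
    (hram : ∀ m : ℕ+, (Icc (O.valuation ((m : ℕ) : N)) 1).Finite)
    (hprep : ∀ (M : Type w) [Field M] [CharZero M] [L.Structure M] (O' : ValuationSubring M),
      IsValuedFieldExpansion φ O' → (N ↪ₑ[L] M) → HasFinitePreparation L O')
    (hsph : ¬ IsSphericallyComplete O) :
    ∃ (P : Type w) (_ : L.Structure P) (j : N ↪ₑ[L] P),
      IsImmediateEmbedding φ j ∧ ¬ Function.Surjective j := by
  simp only [IsSphericallyComplete, not_forall, not_nonempty_iff_eq_empty] at hsph
  obtain ⟨𝓑, hball, hchain, hempty⟩ := hsph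
  have h𝓑 : 𝓑.Nonempty := by
    rw [nonempty_iff_ne_empty]
    rintro rfl
    simp at hempty
  obtain ⟨M, _, j, a, ha⟩ :=
    exists_elementaryEmbedding_of_chain (L := L) h𝓑 hchain fun B hB => (hball B hB).nonempty
  obtain ⟨_, O', hM⟩ := hN.exists_of_elementarilyEquivalent j.elementarilyEquivalent
  have : CharZero M := charZero_of_injective_ringHom (j.toRingHom hN hM).injective
  have hR := j.meetsDefinable_range
  have hle : ∀ x y, O'.valuation (j x) ≤ O'.valuation (j y) ↔ O.valuation x ≤ O.valuation y :=
    fun x y => valuation_map_le_iff_of_comap_eq (j.comap_toRingHom hN hM)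
  have hsubm : ∀ x y, j (x - y) = j x - j y := fun x y => map_sub (j.toRingHom hN hM) x y
  have hj0 : j 0 = 0 := map_zero (j.toRingHom hN hM)
  -- The ball of `M` with the same centre and radius.
  have hhat : ∀ B ∈ 𝓑, ∃ B' : Set M, (range j).Definable₁ L B' ∧ a ∈ B' ∧
      ∀ x, j x ∈ B' ↔ x ∈ B := by
    intro B hB
    obtain ⟨b, r, -, h⟩ := hball B hB
    obtain ⟨d, rfl⟩ := O.valuation_surjective r
    have hb : (range j).DefinableFun L fun _ : Fin 1 → M => j b :=
      L.definableFun_const _ (mem_range_self b)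
    have hd : (range j).DefinableFun L fun _ : Fin 1 → M => j d :=
      L.definableFun_const _ (mem_range_self d)
    rcases h with rfl | rfl
    · refine ⟨{x | ¬ O'.valuation (j d) ≤ O'.valuation (x - j b)},
        (hM.definable_valuation_le hd (hM.definableFun_sub (.proj L) hb)).not, ?_, fun x => ?_⟩
      -- On `(x, b, d, 0)` the relabelled formula reads `|d - 0| ≤ |x - b|`; its negation is the
      -- open ball.
      · have := ha 3 ((valuationSubLE φ).relabel ![2, 3, 0, 1]).not ![b, d, 0] _ hB ?_
        · rw [Formula.realize_not, Formula.realize_relabel, hM.realize_valuationSubLE] at this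
          have h' : ¬ O'.valuation (j d - j 0) ≤ O'.valuation (a - j b) := this
          simpa [hj0] using h'
        · intro x hx
          simpa [Formula.realize_relabel, hN.realize_valuationSubLE, Fin.cons] using hx
      · rw [mem_ofPred_eq, mem_ofPred_eq, ← hsubm, hle, not_le]
    · refine ⟨{x | O'.valuation (x - j b) ≤ O'.valuation (j d)},
        hM.definable_valuation_le (hM.definableFun_sub (.proj L) hb) hd, ?_, fun x => ?_⟩
      · have := ha 3 (valuationSubLE φ) ![b, d, 0] _ hB ?_
        · rw [hM.realize_valuationSubLE] at this
          have h' : O'.valuation (a - j b) ≤ O'.valuation (j d - j 0) := this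
          simpa [hj0] using h'
        · intro x hx
          simpa [hN.realize_valuationSubLE, Fin.cons] using hx
      · simp only [mem_ofPred_eq, ← hsubm, hle]
  choose! hat hdef ha' hmem using hhat
  have hmono : ∀ B ∈ 𝓑, ∀ B' ∈ 𝓑, B ⊆ B' → hat B ⊆ hat B' := by
    intro B hB B' hB' hsub
    by_contra hnot
    obtain ⟨z, hz, hz'⟩ := not_subset.1 hnot
    obtain ⟨_, ⟨h1, h2⟩, x, rfl⟩ := hR (hat B \ hat B') ⟨z, hz, hz'⟩
      ((hdef B hB).sdiff (hdef B' hB'))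
    exact h2 ((hmem B' hB' x).2 (hsub ((hmem B hB x).1 h1)))
  have hctrl : IsRVControlled L O' (range j) (insert a (range j)) := by
    refine .insert_of_mem_chain hM (hprep M O' hM j) hR (h𝓑.image hat) ?_ ?_ ?_ ?_
    · rintro _ ⟨B, hB, rfl⟩ _ ⟨B', hB', rfl⟩ -
      exact (hchain.total hB hB').imp (hmono B hB B' hB') (hmono B' hB' B hB)
    · rintro _ ⟨B, hB, rfl⟩
      exact hdef B hB
    · rintro _ ⟨c, rfl⟩ m
      obtain ⟨B, hB, hconst⟩ := exists_ball_rv_sub_eq hball hchain hempty m (hram m) c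
      refine ⟨hat B, ⟨B, hB, rfl⟩, ?_⟩
      have hrv : ∀ x x' : N, rv O (natRadius O m) x = rv O (natRadius O m) x' →
          rv O' (natRadius O' m) (j x) = rv O' (natRadius O' m) (j x') := by
        intro x x' h
        have hmul : j ((m : ℕ) * x') = (m : ℕ) * j x' := by
          rw [← map_natCast (j.toRingHom hN hM)]
          exact map_mul (j.toRingHom hN hM) _ _
        rw [rv_natRadius_eq_iff, ← hsubm, ← hmul, hle]
        rcases rv_natRadius_eq_iff.1 h with ⟨rfl, rfl⟩ | h
        exacts [Or.inl ⟨hj0, hj0⟩, Or.inr h]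
      have hc : ∀ {k}, (range j).DefinableFun L fun _ : k → M => j c :=
        L.definableFun_const _ (mem_range_self c)
      -- Constancy passes from `B` to `hat B` by moving a bad pair into the range of `j`, one point
      -- at a time.
      by_contra! hbad
      obtain ⟨z, hz, z', hz', hzz'⟩ := hbad
      obtain ⟨_, ⟨h1, h2⟩, x, rfl⟩ := hR
        {z | z ∈ hat B ∧ ∃ z', z' ∈ hat B ∧
          ¬ rv O' (natRadius O' m) (z - j c) = rv O' (natRadius O' m) (z' - j c)}
        ⟨z, hz, z', hz', hzz'⟩
        (Definable.and (Definable.comp_one (hdef B hB) (.proj L))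
          (.exists_one (P := fun z' (v : Fin 1 → M) => z' ∈ hat B ∧
            ¬ rv O' (natRadius O' m) (v 0 - j c) = rv O' (natRadius O' m) (z' - j c))
          ((Definable.comp_one (hdef B hB) (.proj L)).and
            (hM.definable_rv_eq m (hM.definableFun_sub (.proj L) hc)
              (hM.definableFun_sub (.proj L) hc)).not)))
      obtain ⟨_, ⟨h3, h4⟩, x', rfl⟩ := hR
        {z' | z' ∈ hat B ∧
          ¬ rv O' (natRadius O' m) (j x - j c) = rv O' (natRadius O' m) (z' - j c)} h2
        (Definable.and (Definable.comp_one (hdef B hB) (.proj L))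
          (hM.definable_rv_eq m (hM.definableFun_sub
            (L.definableFun_const _ (mem_range_self x)) hc)
              (hM.definableFun_sub (.proj L) hc)).not)
      refine h4 ?_
      rw [← hsubm, ← hsubm]
      exact hrv _ _ (hconst x ((hmem B hB x).1 h1) x' ((hmem B hB x').1 h3))
    · rintro _ ⟨B, hB, rfl⟩
      exact ha' B hB
  obtain ⟨A, hA, hmax⟩ := hctrl.exists_maximal
  have hAM := IsRVControlled.meetsDefinable_of_maximal hM (hprep M O' hM j) hmax
  let S := hAM.toElementarySubstructure
  have hS : ∀ x, x ∈ S ↔ x ∈ A := fun x => by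
    conv_rhs => rw [← hAM.closure_eq_self]
    rfl
  have hjS : ∀ x, j x ∈ S := fun x => (hS _).2 (hA (mem_insert_of_mem _ (mem_range_self x)))
  let k : N ↪ₑ[L] S := ⟨fun x => ⟨j x, hjS x⟩, fun n θ x => by
    rw [← S.subtype.map_formula, ← j.map_formula]; rfl⟩
  refine ⟨S, inferInstance, k, fun y hy => ?_, fun hsurj => ?_⟩
  · have hyA : (y : M) ∈ A := (hS _).1 y.2
    have hy0 : (y : M) ≠ 0 := fun h => hy (Subtype.ext (h.trans hj0.symm))
    -- The fibre of `rv(y)` is `A`-definable, hence meets the range of `j`.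
    obtain ⟨_, hx, x, rfl⟩ := hmax.prop.meets 1
      {t | rv O' (natRadius O' 1) t = rv O' (natRadius O' 1) y}
      (hM.definable_rv_eq 1 (.proj L) (L.definableFun_const _ hyA))
      (fun t t' h ht => h.symm.trans ht) ⟨y, rfl⟩
    refine ⟨x, fun hx' => ?_⟩
    rw [← S.subtype.map_formula, hM.realize_valuationSubLE] at hx'
    rcases rv_natRadius_eq_iff.1 hx with ⟨-, h0⟩ | h
    · exact hy0 h0
    · refine h ?_
      rw [Valuation.map_sub_swap]
      have hx'' : O'.valuation ((y : M) - j 0) ≤ O'.valuation ((y : M) - j x) := hx'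
      simpa [hj0] using hx''
  · obtain ⟨x, hx⟩ := hsurj ⟨a, (hS a).2 (hA (mem_insert _ _))⟩
    have hxa : j x = a := congrArg Subtype.val hx
    refine (eq_empty_iff_forall_notMem.1 hempty x) (mem_sInter.2 fun B hB => ?_)
    exact (hmem B hB x).1 (hxa ▸ ha' B hB)

end ImmediateExtension

/-! ### Unions of elementary directed systems. -/

section ElementaryChain

open FirstOrder.Language Set

variable {L : FirstOrder.Language.{u, v}} {ι : Type*} [Preorder ι] [IsDirectedOrder ι] [Nonempty ι]
  {G : ι → Type*} [∀ i, L.Structure (G i)] (f : ∀ i j, i ≤ j → G i ↪ₑ[L] G j)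
  [DirectedSystem G fun i j h => (f i j h).toEmbedding]

/-- In the quantifier step an element of the limit comes from a later stage, to which the elementary
transition maps carry the universal statement. -/
theorem FirstOrder.Language.DirectLimit.realize_of {α : Type*} {n : ℕ} (θ : L.BoundedFormula α n)
    (i : ι) (x : α → G i) (y : Fin n → G i) :
    θ.Realize (DirectLimit.of L ι G (fun i j h => (f i j h).toEmbedding) i ∘ x)
      (DirectLimit.of L ι G (fun i j h => (f i j h).toEmbedding) i ∘ y) ↔ θ.Realize x y := by
  induction θ generalizing i with
  | falsum => rfl
  | equal t₁ t₂ =>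
    simp only [BoundedFormula.Realize, ← Sum.comp_elim, HomClass.realize_term,
      (DirectLimit.of L ι G (fun i j h => (f i j h).toEmbedding) i).injective.eq_iff]
  | rel R ts =>
    simp only [BoundedFormula.Realize, ← Sum.comp_elim, HomClass.realize_term]
    exact (DirectLimit.of L ι G (fun i j h => (f i j h).toEmbedding) i).map_rel R
      fun k => (ts k).realize (Sum.elim x y)
  | imp θ₁ θ₂ ih₁ ih₂ => simp only [BoundedFormula.Realize, ih₁, ih₂]
  | all θ ih =>
    simp only [BoundedFormula.Realize]
    refine ⟨fun h a => ?_, fun h z => ?_⟩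
    · rw [← ih, Fin.comp_snoc]
      exact h _
    · obtain ⟨j, b, rfl⟩ := DirectLimit.exists_of z
      obtain ⟨k, hik, hjk⟩ := directed_of (· ≤ ·) i j
      have h' : θ.all.Realize (f i k hik ∘ x) (f i k hik ∘ y) :=
        ((f i k hik).map_boundedFormula θ.all x y).2 h
      have h'' := (ih k _ _).2 (h' (f j k hjk b))
      rw [Fin.comp_snoc] at h''
      have hof : ∀ {i : ι} (hik : i ≤ k) (a : G i),
          DirectLimit.of L ι G (fun i j h => (f i j h).toEmbedding) k (f i k hik a) =
            DirectLimit.of L ι G (fun i j h => (f i j h).toEmbedding) i a :=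
        fun hik a => DirectLimit.of_f (hij := hik)
      have hcomp : DirectLimit.of L ι G (fun i j h => (f i j h).toEmbedding) k ∘ f i k hik ∘ y =
            DirectLimit.of L ι G (fun i j h => (f i j h).toEmbedding) i ∘ y :=
        funext fun a => hof hik _
      have hcomp' : DirectLimit.of L ι G (fun i j h => (f i j h).toEmbedding) k ∘ f i k hik ∘ x =
            DirectLimit.of L ι G (fun i j h => (f i j h).toEmbedding) i ∘ x :=
        funext fun a => hof hik _
      rwa [hof, hcomp', hcomp] at h''

/-- The components of an elementary directed system embed elementarily in the direct limit. -/
noncomputable def FirstOrder.Language.DirectLimit.ofElementary (i : ι) :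
    G i ↪ₑ[L] DirectLimit G fun i j h => (f i j h).toEmbedding :=
  ⟨DirectLimit.of L ι G (fun i j h => (f i j h).toEmbedding) i, fun n θ x => by
    rw [Formula.Realize, Formula.Realize, ← DirectLimit.realize_of f θ i x default]
    exact iff_of_eq (congrArg _ (Subsingleton.elim _ _))⟩

end ElementaryChain

/-! ### Existence of a maximal immediate elementary extension. -/

section MaximalImmediate

open FirstOrder.Language Set

variable {L : FirstOrder.Language.{u, v}} {φ : valuedFieldLanguage →ᴸ L} {K : Type w} [Field K]
  [L.Structure K]

/-- An immediate extension of `K` has at most as many elements as there are maps `K → K`. -/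
theorem IsImmediateEmbedding.nonempty_embedding {O : ValuationSubring K}
    (hK : IsValuedFieldExpansion φ O) {N : Type w} [L.Structure N] {j : K ↪ₑ[L] N}
    (hj : IsImmediateEmbedding φ j) : Nonempty (N ↪ (K → K)) := by
  obtain ⟨_, O', hN⟩ := hK.exists_of_elementarilyEquivalent j.elementarilyEquivalent
  have hj0 : j 0 = 0 := map_zero (j.toRingHom hK hN)
  have hval := (hj.isImmediateExtension hK hN).value
  rw [isImmediateEmbedding_iff hK hN] at hj
  -- A centre depending only on the closed ball of radius `|j k|` around `x`. Assigning to `k` an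
  -- approximation `g x k` of `x - ctr x k` determines `x`: if `|x - y| = |j k|`, the centres agree,
  -- and equal approximations would bring `x` and `y` closer.
  let ctr (x : N) (k : K) : N :=
    Classical.epsilon fun a => O'.valuation (x - a) ≤ O'.valuation (j k)
  have hctr : ∀ x k, O'.valuation (x - ctr x k) ≤ O'.valuation (j k) := fun x k =>
    Classical.epsilon_spec (p := fun a => O'.valuation (x - a) ≤ O'.valuation (j k))
      ⟨x, by simp⟩
  have hctr_eq : ∀ x y k, O'.valuation (x - y) ≤ O'.valuation (j k) → ctr x k = ctr y k := by
    intro x y k h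
    have : (fun a => O'.valuation (x - a) ≤ O'.valuation (j k)) =
        fun a => O'.valuation (y - a) ≤ O'.valuation (j k) := by
      funext a
      refine propext ⟨fun ha => ?_, fun ha => ?_⟩
      · rw [Valuation.map_sub_swap] at h
        simpa using O'.valuation.map_add_le h ha
      · simpa using O'.valuation.map_add_le h ha
    exact congrArg Classical.epsilon this
  have hres : ∀ x k, ∃ r, k ≠ 0 → O'.valuation (x - ctr x k - j r) < O'.valuation (j k) := by
    intro x k
    rcases (hctr x k).lt_or_eq with h | h
    · exact ⟨0, fun _ => by simpa [hj0] using h⟩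
    · by_cases hk : k = 0
      · exact ⟨0, fun h => absurd hk h⟩
      · obtain ⟨r, hr⟩ := hj (x - ctr x k) (by
          intro h0
          rw [h0, map_zero, eq_comm, map_eq_zero] at h
          exact hk (j.injective (h.trans hj0.symm)))
        exact ⟨r, fun _ => hr.trans_le h.le⟩
  choose g hg using hres
  refine ⟨⟨g, fun x y hxy => ?_⟩⟩
  by_contra hne
  obtain ⟨k, hk⟩ := hval (x - y)
  replace hk : O'.valuation (j k) = O'.valuation (x - y) := hk
  have hk0 : k ≠ 0 := by
    rintro rfl
    rw [hj0, map_zero, eq_comm, map_eq_zero, sub_eq_zero] at hk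
    exact hne hk
  have h1 := hg x k hk0
  have h2 := hg y k hk0
  rw [hxy, hctr_eq x y k hk.ge] at h1
  have := O'.valuation.map_sub_lt h1 h2
  rw [sub_sub_sub_cancel_right, sub_sub_sub_cancel_right, hk] at this
  exact lt_irrefl _ this

variable (φ K) in
/-- An immediate elementary extension of `K`, with an injection of its elements into `S`. -/
structure ImmediateExtensionIn (S : Type w) where
  /-- The underlying type. -/
  carrier : Type w
  [str : L.Structure carrier]
  /-- The embedding of `K`. -/
  base : K ↪ₑ[L] carrier
  isImmediate : IsImmediateEmbedding φ base
  /-- The injection into `S`. -/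
  toSet : carrier ↪ S

namespace ImmediateExtensionIn

variable {S : Type w}

attribute [instance] ImmediateExtensionIn.str

/-- Compatibility with `toSet` makes the embedding unique, so independently chosen embeddings along
a chain commute. -/
instance : Preorder (ImmediateExtensionIn φ K S) where
  le p q := ∃ h : p.carrier ↪ₑ[L] q.carrier,
    (∀ x, h (p.base x) = q.base x) ∧ ∀ x, q.toSet (h x) = p.toSet x
  le_refl p := ⟨.refl L _, fun _ => rfl, fun _ => rfl⟩
  le_trans p q r := fun ⟨h, h1, h2⟩ ⟨k, k1, k2⟩ =>
    ⟨k.comp h, fun x => by simp [h1, k1], fun x => by simp [h2, k2]⟩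

theorem exists_upperBound {c : Set (ImmediateExtensionIn φ K S)} (hc : IsChain (· ≤ ·) c)
    (hne : c.Nonempty) : ∃ ub, ∀ p ∈ c, p ≤ ub := by
  have : Nonempty c := hne.to_subtype
  have : IsDirectedOrder c := ⟨fun p q => (hc.total p.2 q.2).elim
    (fun h => ⟨q, h, le_rfl⟩) (fun h => ⟨p, le_rfl, h⟩)⟩
  let G (p : c) : Type w := p.1.carrier
  let f (p q : c) (h : p ≤ q) : G p ↪ₑ[L] G q := Classical.choose (show p.1 ≤ q.1 from h)
  have hf₁ : ∀ (p q : c) (h : p ≤ q) x, f p q h (p.1.base x) = q.1.base x := fun p q h =>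
    (Classical.choose_spec (show p.1 ≤ q.1 from h)).1
  have hf₂ : ∀ (p q : c) (h : p ≤ q) x, q.1.toSet (f p q h x) = p.1.toSet x := fun p q h =>
    (Classical.choose_spec (show p.1 ≤ q.1 from h)).2
  have : DirectedSystem G fun p q h => (f p q h).toEmbedding :=
    ⟨fun p x => p.1.toSet.injective (hf₂ p p le_rfl x), fun r q p hpq hqr x =>
      r.1.toSet.injective (((hf₂ q r hqr _).trans (hf₂ p q hpq x)).trans
        (hf₂ p r (hpq.trans hqr) x).symm)⟩
  let D := Language.DirectLimit G fun p q h => (f p q h).toEmbedding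
  let o (p : c) : G p ↪ₑ[L] D := Language.DirectLimit.ofElementary f p
  have ho : ∀ p q (h : p ≤ q) x, o q (f p q h x) = o p x := fun p q h x =>
    Language.DirectLimit.of_f (f := fun p q h => (f p q h).toEmbedding) (hij := h)
  have hex : ∀ z : D, ∃ p x, o p x = z := fun z => Language.DirectLimit.exists_of z
  choose idx rep hrep using hex
  let e (z : D) : S := (idx z).1.toSet (rep z)
  have hlevel : ∀ p q x y, p.1.toSet x = q.1.toSet y ↔ o p x = o q y := by
    intro p q x y
    obtain ⟨r, hp, hq⟩ := directed_of (· ≤ ·) p q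
    rw [← ho p r hp, ← ho q r hq, (o r).injective.eq_iff, ← hf₂ p r hp, ← hf₂ q r hq,
      r.1.toSet.injective.eq_iff]
  have he : ∀ p x, e (o p x) = p.1.toSet x := fun p x => (hlevel _ _ _ _).2 (hrep _)
  have heinj : Function.Injective e := fun z z' h => by
    rw [← hrep z, ← hrep z']
    exact (hlevel _ _ _ _).1 h
  -- The limit is indexed by a chain in a larger universe; its image in `S` is a copy in the right
  -- one.
  let E : D ≃ range e := Equiv.ofInjective e heinj
  let : L.Structure (range e) := E.inducedStructure
  let E' : D ↪ₑ[L] range e := E.inducedStructureEquiv.toElementaryEmbedding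
  obtain ⟨p₀⟩ := ‹Nonempty c›
  have hbase : ∀ p x, o p (p.1.base x) = o p₀ (p₀.1.base x) := by
    intro p x
    obtain ⟨r, hp, hq⟩ := directed_of (· ≤ ·) p p₀
    rw [← ho p r hp, ← ho p₀ r hq, hf₁ p r hp, hf₁ p₀ r hq]
  refine ⟨⟨range e, E'.comp ((o p₀).comp p₀.1.base), fun y hy => ?_, .subtype _⟩,
    fun p hp => ⟨E'.comp (o ⟨p, hp⟩), fun x => congrArg E' (hbase ⟨p, hp⟩ x), fun x => ?_⟩⟩
  · obtain ⟨z, rfl⟩ := E.surjective y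
    obtain ⟨p, a, rfl⟩ : ∃ p x, o p x = z := ⟨_, _, hrep z⟩
    obtain ⟨x, hx⟩ := p.1.isImmediate a (by
      rintro rfl
      exact hy (congrArg E' (hbase p 0)))
    refine ⟨x, fun h => hx ?_⟩
    rw [← (E'.comp (o p)).map_formula]
    convert h using 1
    ext i
    fin_cases i
    exacts [rfl, congrArg (fun z => (E' z : S)) (hbase p 0), rfl,
      congrArg (fun z => (E' z : S)) (hbase p x)]
  · exact he ⟨p, hp⟩ x

end ImmediateExtensionIn

/-- Every immediate extension is smaller than `S`, so there is always room in `S` to prolong the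
injection of a Zorn-maximal one to a given further extension. -/
theorem exists_maximal_isImmediateEmbedding [CharZero K] {O : ValuationSubring K}
    (hK : IsValuedFieldExpansion φ O) :
    ∃ (N : Type w) (_ : L.Structure N) (j : K ↪ₑ[L] N), IsImmediateEmbedding φ j ∧
      ∀ (P : Type w) [L.Structure P] (k : N ↪ₑ[L] P),
        IsImmediateEmbedding φ (k.comp j) → Function.Surjective k := by
  classical
  let S := Set (K → K)
  have hcard : ∀ (N : Type w) [L.Structure N] (j : K ↪ₑ[L] N), IsImmediateEmbedding φ j →
      Cardinal.mk N < Cardinal.mk S := fun N _ j hj =>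
    (Cardinal.mk_le_of_injective (hj.nonempty_embedding hK).some.injective).trans_lt
      (by rw [Cardinal.mk_set]; exact Cardinal.cantor _)
  have hrefl : IsImmediateEmbedding φ (ElementaryEmbedding.refl L K) := by
    rw [isImmediateEmbedding_iff hK hK]
    exact fun y hy => ⟨y, by simpa [zero_lt_iff] using hy⟩
  have : Nonempty (ImmediateExtensionIn φ K S) :=
    ⟨⟨K, .refl L K, hrefl, ⟨fun x => {fun _ => x}, fun x y h => by
      simpa using congrFun (singleton_injective h) 0⟩⟩⟩
  obtain ⟨p, hp⟩ := exists_maximal_of_nonempty_chains_bounded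
    (r := ((· ≤ ·) : ImmediateExtensionIn φ K S → _ → Prop))
    (fun c hc hne => ImmediateExtensionIn.exists_upperBound hc hne) le_trans
  refine ⟨p.carrier, p.str, p.base, p.isImmediate, fun P _ k hk => ?_⟩
  have hcompl : Cardinal.mk ((range p.toSet)ᶜ : Set S) = Cardinal.mk S :=
    Cardinal.mk_compl_of_infinite _ (by
      rw [Cardinal.mk_range_eq _ p.toSet.injective]
      exact hcard _ p.base p.isImmediate)
  obtain ⟨g⟩ : Nonempty (P ↪ ((range p.toSet)ᶜ : Set S)) := by
    rw [← Cardinal.le_def, hcompl]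
    exact (hcard P _ hk).le
  let e (y : P) : S := if h : ∃ x, k x = y then p.toSet h.choose else g y
  have he : ∀ x, e (k x) = p.toSet x := fun x => by
    have h : ∃ x', k x' = k x := ⟨x, rfl⟩
    simp only [e, dif_pos h]
    exact congrArg _ (k.injective h.choose_spec)
  have he' : ∀ y, (¬ ∃ x, k x = y) → e y = g y := fun y h => dif_neg h
  have heinj : Function.Injective e := by
    intro y y' h
    by_cases hy : ∃ x, k x = y <;> by_cases hy' : ∃ x, k x = y'
    · obtain ⟨x, rfl⟩ := hy
      obtain ⟨x', rfl⟩ := hy'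
      rw [he, he] at h
      rw [p.toSet.injective h]
    · obtain ⟨x, rfl⟩ := hy
      rw [he, he' y' hy'] at h
      exact absurd ⟨x, h⟩ (g y').2
    · obtain ⟨x', rfl⟩ := hy'
      rw [he, he' y hy] at h
      exact absurd ⟨x', h.symm⟩ (g y).2
    · rw [he' y hy, he' y' hy'] at h
      exact g.injective (Subtype.ext h)
  -- Maximality forces `e` into the range of `p.toSet`, which it avoids outside the range of `k`.
  obtain ⟨h, -, hh⟩ := hp ⟨P, k.comp p.base, hk, ⟨e, heinj⟩⟩ ⟨k, fun _ => rfl, he⟩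
  intro y
  by_contra hy
  have h1 : p.toSet (h y) = e y := hh y
  rw [he' y hy] at h1
  exact (g y).2 ⟨_, h1⟩

end MaximalImmediate

/-! ### Spherical completeness implies maximality. -/

section SphericallyComplete

/-- A spherically complete valued field has no proper immediate extension. -/
theorem IsSphericallyComplete.isMaximalValuedField {K : Type w} [Field K] {O : ValuationSubring K}
    (h : IsSphericallyComplete O) : IsMaximalValuedField O := by
  intro K' _ O' i hi y
  by_contra! hy
  have hle : ∀ x z, O'.valuation (i x) ≤ O'.valuation (i z) ↔ O.valuation x ≤ O.valuation z :=
    fun x z => valuation_map_le_iff_of_comap_eq hi.comap_eq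
  choose b hb using fun a : K => hi.value (y - i a)
  have hb0 : ∀ a, b a ≠ 0 := fun a h0 => by
    have := hb a
    rw [h0, map_zero, map_zero, eq_comm, map_eq_zero, sub_eq_zero] at this
    exact hy a this.symm
  have hmem : ∀ a x, x ∈ {x | O.valuation (x - a) ≤ O.valuation (b a)} ↔
      O'.valuation (i x - i a) ≤ O'.valuation (y - i a) := fun a x => by
    rw [← hb, ← map_sub, hle]; rfl
  have hsub : ∀ a a', O'.valuation (y - i a) ≤ O'.valuation (y - i a') →
      {x | O.valuation (x - a) ≤ O.valuation (b a)} ⊆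
        {x | O.valuation (x - a') ≤ O.valuation (b a')} := by
    intro a a' haa' x hx
    rw [hmem] at hx ⊢
    have h1 := O'.valuation.map_sub_le (hx.trans haa') haa'
    have h2 := O'.valuation.map_add_le h1 (le_refl (O'.valuation (y - i a')))
    rwa [show i x - i a - (y - i a) + (y - i a') = i x - i a' by ring] at h2
  -- A point common to the balls around `a` of radius `|y - i a|` is a best approximation to `y`;
  -- the residue `d` below improves it.
  obtain ⟨x, hx⟩ := h (Set.range fun a => {x | O.valuation (x - a) ≤ O.valuation (b a)})
    (by
      rintro _ ⟨a, rfl⟩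
      exact ⟨a, O.valuation (b a), (Valuation.ne_zero_iff _).2 (hb0 a), Or.inr rfl⟩)
    (by
      rintro _ ⟨a, rfl⟩ _ ⟨a', rfl⟩ -
      exact (le_total _ _).imp (hsub a a') (hsub a' a))
  have hxa : ∀ a, O'.valuation (i x - i a) ≤ O'.valuation (y - i a) := fun a =>
    (hmem a x).1 (Set.mem_sInter.1 hx _ ⟨a, rfl⟩)
  have hbx : i (b x) ≠ 0 := (map_ne_zero i).2 (hb0 x)
  have hv : O'.valuation ((y - i x) / i (b x)) = 1 := by
    rw [map_div₀, ← hb x, div_self ((Valuation.ne_zero_iff _).2 hbx)]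
  obtain ⟨d, -, hd⟩ := hi.residue ((y - i x) / i (b x)) ((O'.valuation_le_one_iff _).1 hv.le)
  have hpos : 0 < O'.valuation (i (b x)) := (Valuation.pos_iff _).2 hbx
  have hlt : O'.valuation (y - i (x + b x * d)) < O'.valuation (i (b x)) := by
    have e : y - i (x + b x * d) = ((y - i x) / i (b x) - i d) * i (b x) := by
      rw [map_add, map_mul]
      field_simp
      ring
    rw [e, map_mul]
    exact mul_lt_of_lt_one_left hpos hd
  have hd1 : O'.valuation (i d) = 1 := by
    rw [← hv] at hd
    have := O'.valuation.map_sub_eq_of_lt_left hd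
    rwa [sub_sub_cancel, hv] at this
  have := (hxa (x + b x * d)).trans_lt hlt
  rw [map_add, sub_add_cancel_left, Valuation.map_neg, map_mul, map_mul, hd1, mul_one] at this
  exact lt_irrefl _ this

end SphericallyComplete

/-! ### Finiteness of the values between `|m|` and `1`. -/

section Ramification

variable {K : Type w} [Field K] {O : ValuationSubring K}

theorem valuation_natCast_eq_one_iff {m : ℕ} :
    O.valuation (m : K) = 1 ↔ (m : IsLocalRing.ResidueField O) ≠ 0 := by
  have h1 : ((m : O) : K) = m := by simp
  rw [← h1, ← O.valuation_eq_one_iff, ← map_natCast (IsLocalRing.residue O),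
    IsLocalRing.residue_ne_zero_iff_isUnit]

theorem finite_Icc_valuation_natCast_of_charZero [CharZero (IsLocalRing.ResidueField O)] (m : ℕ+) :
    (Set.Icc (O.valuation ((m : ℕ) : K)) 1).Finite := by
  rw [valuation_natCast_eq_one_iff.2 (Nat.cast_ne_zero.2 m.ne_zero), Set.Icc_self]
  exact Set.finite_singleton 1

/-- Only the `p`-part of `m` affects `|m|`, and `[|p|^(k+1), 1]` is covered by `[|p|, 1]` and `|p| ·
[|p|^k, 1]`. -/
theorem IsFinitelyRamified.finite_Icc_valuation_natCast [CharZero K] {p : ℕ} (hp : p.Prime)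
    (h : IsFinitelyRamified O p) (m : ℕ+) : (Set.Icc (O.valuation ((m : ℕ) : K)) 1).Finite := by
  obtain ⟨hchar, hfin⟩ := h
  have hpow : ∀ k : ℕ, (Set.Icc (O.valuation (p : K) ^ k) 1).Finite := by
    intro k
    induction k with
    | zero => simp
    | succ k ih =>
      have hp0 : 0 < O.valuation (p : K) :=
        (Valuation.pos_iff _).2 (Nat.cast_ne_zero.2 hp.ne_zero)
      refine (hfin.union (ih.image (· * O.valuation (p : K)))).subset ?_
      rintro γ ⟨h1, h2⟩
      rcases le_total (O.valuation (p : K)) γ with hle | hle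
      · exact Or.inl ⟨hle, h2⟩
      · refine Or.inr ⟨γ / O.valuation (p : K), ⟨?_, (div_le_one₀ hp0).2 hle⟩,
          div_mul_cancel₀ _ hp0.ne'⟩
        rwa [le_div_iff₀ hp0, ← pow_succ]
  obtain ⟨k, m', hm', hm⟩ := Nat.exists_eq_pow_mul_and_not_dvd m.ne_zero p hp.ne_one
  have hm1 : O.valuation (m' : K) = 1 :=
    valuation_natCast_eq_one_iff.2 fun h0 => hm' ((CharP.cast_eq_zero_iff _ p m').1 h0)
  rw [hm, Nat.cast_mul, map_mul, hm1, mul_one, Nat.cast_pow, map_pow]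
  exact hpow k

theorem IsImmediateExtension.finite_Icc {K' : Type*} [Field K'] {O' : ValuationSubring K'}
    {i : K →+* K'} (hi : IsImmediateExtension O O' i) {x : K}
    (hfin : (Set.Icc (O.valuation x) 1).Finite) : (Set.Icc (O'.valuation (i x)) 1).Finite := by
  have hle : ∀ x z, O'.valuation (i x) ≤ O'.valuation (i z) ↔ O.valuation x ≤ O.valuation z :=
    fun x z => valuation_map_le_iff_of_comap_eq hi.comap_eq
  have hex : ∀ γ : O'.ValueGroup, ∃ z, O'.valuation (i z) = γ := fun γ => by
    obtain ⟨y, rfl⟩ := O'.valuation_surjective γ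
    exact hi.value y
  choose g hg using hex
  refine Set.Finite.of_injOn (f := fun γ => O.valuation (g γ)) (t := Set.Icc (O.valuation x) 1)
    ?_ ?_ hfin
  · rintro γ ⟨h1, h2⟩
    rw [← hg γ] at h1 h2
    refine ⟨(hle _ _).1 h1, ?_⟩
    rw [← O.valuation.map_one, ← hle, map_one, map_one]
    exact h2
  · intro γ _ γ' _ h
    have h' : O.valuation (g γ) = O.valuation (g γ') := h
    rw [← hg γ, ← hg γ']
    exact le_antisymm ((hle _ _).2 h'.le) ((hle _ _).2 h'.ge)

end Ramification

/-! ### Conclusion. -/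

section Existence

open FirstOrder.Language

variable {L : FirstOrder.Language.{u, v}} {φ : valuedFieldLanguage →ᴸ L}

/-- The cases of equal and of mixed characteristic both yield finite preparation in all models. -/
theorem hasFinitePreparation_of_minimal {K : Type w} [Field K] [CharZero K] [L.Structure K]
    {O : ValuationSubring K} (hK : IsValuedFieldExpansion φ O)
    (hmin :
      (CharZero (IsLocalRing.ResidueField O) ∧
        IsZeroHMinimal.{u, v, max u v w} φ (L.completeTheory K)) ∨
      (∃ p : ℕ, p.Prime ∧ IsFinitelyRamified O p ∧
        IsZeroHMixMinimal.{u, v, max u v w} φ (L.completeTheory K)))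
    {M : Type (max u v w)} [Field M] [CharZero M] [L.Structure M] {O' : ValuationSubring M}
    (hM : IsValuedFieldExpansion φ O') (j : K ↪ₑ[L] M) : HasFinitePreparation L O' := by
  have hT : M ⊨ L.completeTheory K := (j.theory_model_iff _).1 inferInstance
  rcases hmin with ⟨hres, hmin⟩ | ⟨p, -, -, hmin⟩
  -- In residue characteristic `0` all `|n|` are `1`, so every `RV_{|n|}` is `RV_1`.
  · have hone : ∀ n : ℕ+, natRadius O' n = oneRadius O' := fun n => by
      refine Subtype.ext ?_
      have hle : ∀ x z, O'.valuation (j x) ≤ O'.valuation (j z) ↔ O.valuation x ≤ O.valuation z :=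
        fun x z => valuation_map_le_iff_of_comap_eq (j.comap_toRingHom hK hM)
      have h1 : O.valuation ((n : ℕ) : K) = 1 :=
        valuation_natCast_eq_one_iff.2 (Nat.cast_ne_zero.2 n.ne_zero)
      have hjn : j ((n : ℕ) : K) = ((n : ℕ) : M) := map_natCast (j.toRingHom hK hM) _
      have hj1 : j 1 = 1 := map_one (j.toRingHom hK hM)
      have h2 := hle 1 ((n : ℕ) : K)
      rw [hjn, hj1, map_one, map_one, h1] at h2
      exact le_antisymm (natRadius O' n).2.2 (h2.2 le_rfl)
    intro n A X hX
    rw [hone] at hX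
    obtain ⟨C, hfin, hC, hX⟩ := hmin M O' hM hT A X hX
    refine ⟨1, C, hfin, hC, ?_⟩
    rwa [hone]
  · exact hmin M O' hM hT

end Existence

theorem mainTheorem1 {L : FirstOrder.Language.{u, v}} (φ : valuedFieldLanguage →ᴸ L)
    (K : Type w) [Field K] [CharZero K] [L.Structure K] (O : ValuationSubring K)
    (hK : IsValuedFieldExpansion φ O)
    (hmin :
      (CharZero (IsLocalRing.ResidueField O) ∧
        IsZeroHMinimal.{u, v, max u v w} φ (L.completeTheory K)) ∨
      (∃ p : ℕ, p.Prime ∧ IsFinitelyRamified O p ∧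
        IsZeroHMixMinimal.{u, v, max u v w} φ (L.completeTheory K))) :
    ∃ (N : Type (max u v w)) (_ : Field N) (_ : L.Structure N) (O' : ValuationSubring N)
      (i : K →+* N) (j : K ↪ₑ[L] N),
      IsValuedFieldExpansion φ O' ∧ (∀ x, j x = i x) ∧
        IsImmediateExtension O O' i ∧ IsSphericallyComplete O' ∧ IsMaximalValuedField O' := by
  have hram : ∀ m : ℕ+, (Set.Icc (O.valuation ((m : ℕ) : K)) 1).Finite := by
    rcases hmin with ⟨hres, -⟩ | ⟨p, hp, hram, -⟩
    · exact finite_Icc_valuation_natCast_of_charZero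
    · exact hram.finite_Icc_valuation_natCast hp
  -- `K` is copied into the universe over whose models the minimality hypothesis ranges.
  obtain ⟨K₁, _, l, hsurj⟩ : ∃ (K₁ : Type (max u v w)) (_ : L.Structure K₁) (l : K ↪ₑ[L] K₁),
      Function.Surjective l :=
    let E : K ≃ ULift.{max u v w} K := Equiv.ulift.symm
    let : L.Structure (ULift.{max u v w} K) := E.inducedStructure
    ⟨ULift.{max u v w} K, this, E.inducedStructureEquiv.toElementaryEmbedding,
      E.surjective⟩
  obtain ⟨_, O₁, hK₁⟩ := hK.exists_of_elementarilyEquivalent l.elementarilyEquivalent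
  have : CharZero K₁ := charZero_of_injective_ringHom (l.toRingHom hK hK₁).injective
  have hl : IsImmediateEmbedding φ l := by
    rw [isImmediateEmbedding_iff hK hK₁]
    intro y hy
    obtain ⟨x, rfl⟩ := hsurj y
    exact ⟨x, by simpa [zero_lt_iff] using hy⟩
  obtain ⟨N, _, j, hj, hmax⟩ := exists_maximal_isImmediateEmbedding hK₁
  obtain ⟨_, O', hN⟩ := hK₁.exists_of_elementarilyEquivalent j.elementarilyEquivalent
  have : CharZero N := charZero_of_injective_ringHom (j.toRingHom hK₁ hN).injective
  have himm := (hj.comp hK hK₁ hl).isImmediateExtension hK hN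
  have hramN : ∀ m : ℕ+, (Set.Icc (O'.valuation ((m : ℕ) : N)) 1).Finite := fun m => by
    simpa using himm.finite_Icc (hram m)
  have hsph : IsSphericallyComplete O' := by
    by_contra hsph
    obtain ⟨P, _, k, hk, hsurj⟩ := exists_isImmediateEmbedding_not_surjective hN hramN
      (fun M _ _ _ O'' hM e => hasFinitePreparation_of_minimal hK hmin hM (e.comp (j.comp l))) hsph
    exact hsurj (hmax P k (hk.comp hK₁ hN hj))
  exact ⟨N, inferInstance, inferInstance, O', (j.comp l).toRingHom hK hN, j.comp l, hN,
    fun _ => rfl, himm, hsph, hsph.isMaximalValuedField⟩
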